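/- Theorem. Fix a countably infinite set of variables and a countably infinite set $\sigma_0$ of unary relation symbols, and let $\mathrm{succ}$, $<$ and $R$ be binary relation symbols. For a set $\tau$ of binary symbols, the one-dimensional fragment $\mathrm{F}_1$ over $\sigma_0\cup\tau$ is the smallest set of first-order formulas that contains all atoms over $\sigma_0\cup\tau$ and all equalities $x=y$, is closed under $\vee$ and $\neg$, and contains, for every $\varphi$ in it whose free variables are exactly the distinct variables $x_0,\dots,x_k$, the formulas $\exists x_0\dots x_k\,\varphi$ and $\exists x_1\dots x_k\,\varphi$. Consider structures that interpret $\sigma_0\cup\{\mathrm{succ},<,R\}$, with $R$ and the unary symbols interpreted arbitrarily. Such a structure is a word if it is finite and non-empty, $<$ is a strict linear order on it and $\mathrm{succ}$ is the successor relation induced by $<$; it is an $\omega$-word if its reduct to $\{\mathrm{succ},<\}$ is isomorphic to $(\mathbb{N},+1,<)$. Then each of the following four problems is undecidable: (1) given a sentence of $\mathrm{F}_1$ over $\sigma_0\cup\{\mathrm{succ},R\}$, decide whether it is true in some word; (2) given a sentence of $\mathrm{F}_1$ over $\sigma_0\cup\{\mathrm{succ},R\}$, decide whether it is true in some $\omega$-word;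 (3) given a sentence of $\mathrm{F}_1$ over $\sigma_0\cup\{<,R\}$, decide whether it is true in some word; (4) given a sentence of $\mathrm{F}_1$ over $\sigma_0\cup\{<,R\}$, decide whether it is true in some $\omega$-word. -/

import Mathlib

namespace OneDim

/-- The binary relation symbols: the navigational symbols `succ` and `less` of words, and one
further symbol `rel`, whose interpretation is arbitrary. -/
inductive BinSym : Type
  | succ : BinSym
  | less : BinSym
  | rel : BinSym

/-- First-order relational formulas with equality. Variables are natural numbers, and there is
an unlimited supply `P 0, P 1, …` of unary relation symbols. -/
inductive Formula : Type
  /-- `unary p x` is the atom `P p (x)`. -/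
  | unary : ℕ → ℕ → Formula
  /-- `bin s x y` is the atom `s(x, y)`. -/
  | bin : BinSym → ℕ → ℕ → Formula
  /-- `eq x y` is the atom `x = y`. -/
  | eq : ℕ → ℕ → Formula
  | or : Formula → Formula → Formula
  | neg : Formula → Formula
  /-- `ex x φ` is `∃ x, φ`. -/
  | ex : ℕ → Formula → Formula

namespace Formula

/-- The set of free variables. -/
def freeVars : Formula → Finset ℕ
  | unary _ x => {x}
  | bin _ x y => {x, y}
  | eq x y => {x, y}
  | or φ ψ => φ.freeVars ∪ ψ.freeVars
  | neg φ => φ.freeVars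
  | ex x φ => φ.freeVars.erase x

/-- The formula `∃ x₁ … xₖ, φ`, for a list `[x₁, …, xₖ]` of variables. -/
def exBlock (xs : List ℕ) (φ : Formula) : Formula :=
  xs.foldr ex φ

/-- The one-dimensional fragment over the signature consisting of all unary symbols and of the
binary symbols in `σ`: quantification is restricted to blocks of existential quantifiers that bind
all free variables, or all of them but one. -/
inductive IsOneDim (σ : Set BinSym) : Formula → Prop
  | unary (p x : ℕ) : IsOneDim σ (unary p x)
  | bin (s : BinSym) (hs : s ∈ σ) (x y : ℕ) : IsOneDim σ (bin s x y)
  | eq (x y : ℕ) : IsOneDim σ (eq x y)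
  | or (φ ψ : Formula) : IsOneDim σ φ → IsOneDim σ ψ → IsOneDim σ (or φ ψ)
  | neg (φ : Formula) : IsOneDim σ φ → IsOneDim σ (neg φ)
  | exAll (x₀ : ℕ) (xs : List ℕ) (φ : Formula) : IsOneDim σ φ →
      (x₀ :: xs).Nodup → (x₀ :: xs).toFinset = φ.freeVars → IsOneDim σ (exBlock (x₀ :: xs) φ)
  | exAllButOne (x₀ : ℕ) (xs : List ℕ) (φ : Formula) : IsOneDim σ φ →
      (x₀ :: xs).Nodup → (x₀ :: xs).toFinset = φ.freeVars → IsOneDim σ (exBlock xs φ)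

/-- The set of sentences of the one-dimensional fragment over the binary symbols in `σ`. -/
def oneDimSentences (σ : Set BinSym) : Set Formula :=
  {φ | φ.IsOneDim σ ∧ φ.freeVars = ∅}

/-! ### A Gödel numbering of formulas

Formulas are numbered bijectively: the last octal digit of the number of a formula is its outermost
symbol, and the remaining digits number its immediate components. This fixes what it means for a
predicate on formulas to be computable. -/

/-- The Gödel number of a formula. -/
def toNat : Formula → ℕ
  | unary p x => 8 * Nat.pair p x
  | bin .succ x y => 8 * Nat.pair x y + 1
  | bin .less x y => 8 * Nat.pair x y + 2
  | bin .rel x y => 8 * Nat.pair x y + 3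
  | eq x y => 8 * Nat.pair x y + 4
  | or φ ψ => 8 * Nat.pair φ.toNat ψ.toNat + 5
  | neg φ => 8 * φ.toNat + 6
  | ex x φ => 8 * Nat.pair x φ.toNat + 7

theorem exists_toNat (n : ℕ) : ∃ φ : Formula, φ.toNat = n := by
  induction n using Nat.strong_induction_on with
  | _ n ih =>
    obtain ⟨k, r, hr, rfl⟩ : ∃ k r, r < 8 ∧ n = 8 * k + r :=
      ⟨n / 8, n % 8, Nat.mod_lt _ (by norm_num), (Nat.div_add_mod n 8).symm⟩
    have h1 := k.unpair_left_le
    have h2 := k.unpair_right_le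
    interval_cases r
    · exact ⟨unary k.unpair.1 k.unpair.2, by simp [toNat]⟩
    · exact ⟨bin .succ k.unpair.1 k.unpair.2, by simp [toNat]⟩
    · exact ⟨bin .less k.unpair.1 k.unpair.2, by simp [toNat]⟩
    · exact ⟨bin .rel k.unpair.1 k.unpair.2, by simp [toNat]⟩
    · exact ⟨eq k.unpair.1 k.unpair.2, by simp [toNat]⟩
    · obtain ⟨φ, hφ⟩ := ih k.unpair.1 (by omega)
      obtain ⟨ψ, hψ⟩ := ih k.unpair.2 (by omega)
      exact ⟨or φ ψ, by simp [toNat, hφ, hψ]⟩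
    · obtain ⟨φ, hφ⟩ := ih k (by omega)
      exact ⟨neg φ, by simp [toNat, hφ]⟩
    · obtain ⟨φ, hφ⟩ := ih k.unpair.2 (by omega)
      exact ⟨ex k.unpair.1 φ, by simp [toNat, hφ]⟩

theorem toNat_injective : Function.Injective toNat := by
  have aux {a b r : ℕ} (h : 8 * a + r = 8 * b + r) : a = b := by omega
  intro φ
  induction φ with
  | unary p x =>
    rintro (_ | ⟨_ | _ | _, _⟩ | _ | _ | _ | _) h <;> simp only [toNat] at h <;> try omega
    have := Nat.pair_eq_pair.1 (aux (r := 0) h)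
    simp [this]
  | bin s x y =>
    rcases s with _ | _ | _ <;>
    · rintro (_ | ⟨_ | _ | _, _⟩ | _ | _ | _ | _) h <;> simp only [toNat] at h <;> try omega
      have := Nat.pair_eq_pair.1 (aux h)
      simp [this]
  | eq x y =>
    rintro (_ | ⟨_ | _ | _, _⟩ | _ | _ | _ | _) h <;> simp only [toNat] at h <;> try omega
    have := Nat.pair_eq_pair.1 (aux h)
    simp [this]
  | or φ ψ ihφ ihψ =>
    rintro (_ | ⟨_ | _ | _, _⟩ | _ | _ | _ | _) h <;> simp only [toNat] at h <;> try omega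
    have := Nat.pair_eq_pair.1 (aux h)
    rw [ihφ this.1, ihψ this.2]
  | neg φ ihφ =>
    rintro (_ | ⟨_ | _ | _, _⟩ | _ | _ | _ | _) h <;> simp only [toNat] at h <;> try omega
    rw [ihφ (aux h)]
  | ex x φ ihφ =>
    rintro (_ | ⟨_ | _ | _, _⟩ | _ | _ | _ | _) h <;> simp only [toNat] at h <;> try omega
    have := Nat.pair_eq_pair.1 (aux h)
    rw [this.1, ihφ this.2]

noncomputable instance instDenumerable : Denumerable Formula :=
  Denumerable.mk' (Equiv.ofBijective toNat ⟨toNat_injective, exists_toNat⟩)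

theorem encode_eq_toNat (φ : Formula) : Encodable.encode φ = φ.toNat :=
  rfl

end Formula

/-- A structure with domain `M` interpreting the unary symbols and the binary symbols. -/
structure Interp (M : Type) where
  unary : ℕ → M → Prop
  bin : BinSym → M → M → Prop

namespace Interp

variable {M : Type}

/-- Truth of a formula under an assignment of elements to variables. -/
def Holds (I : Interp M) : (ℕ → M) → Formula → Prop
  | v, .unary p x => I.unary p (v x)
  | v, .bin s x y => I.bin s (v x) (v y)
  | v, .eq x y => v x = v y
  | v, .or φ ψ => I.Holds v φ ∨ I.Holds v ψ
  | v, .neg φ => ¬ I.Holds v φ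
  | v, .ex x φ => ∃ a : M, I.Holds (Function.update v x a) φ

/-- `I` is a model of `φ` (used for sentences, whose truth does not depend on the assignment). -/
def Models (I : Interp M) (φ : Formula) : Prop :=
  ∀ v : ℕ → M, I.Holds v φ

/-- `I` is a (finite, non-empty) word: `less` is a strict linear order and `succ` is its induced
successor relation. Nothing is required of `rel` and of the unary symbols. -/
structure IsWord (I : Interp M) : Prop where
  finite : Finite M
  nonempty : Nonempty M
  linear : IsStrictTotalOrder M (I.bin .less)
  succ_iff : ∀ a b, I.bin .succ a b ↔
    I.bin .less a b ∧ ¬ ∃ c, I.bin .less a c ∧ I.bin .less c b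

/-- `I` is an ω-word: the reduct of `I` to `succ` and `less` is isomorphic to `(ℕ, +1, <)`. Nothing
is required of `rel` and of the unary symbols. -/
def IsOmegaWord (I : Interp M) : Prop :=
  ∃ e : ℕ ≃ M, ∀ i j : ℕ,
    (I.bin .succ (e i) (e j) ↔ j = i + 1) ∧ (I.bin .less (e i) (e j) ↔ i < j)

end Interp

/-- `φ` is satisfiable over finite words (with an additional binary relation). -/
def SatOverWords (φ : Formula) : Prop :=
  ∃ (M : Type) (I : Interp M), I.IsWord ∧ I.Models φ

/-- `φ` is satisfiable over ω-words (with an additional binary relation). -/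
def SatOverOmegaWords (φ : Formula) : Prop :=
  ∃ (M : Type) (I : Interp M), I.IsOmegaWord ∧ I.Models φ

/-- The problem "given a formula in `L`, does it satisfy `S`?" is decidable: some computable
predicate on formulas answers correctly on every input from `L`. -/
def DecidableProblem (L : Set Formula) (S : Formula → Prop) : Prop :=
  ∃ p : Formula → Prop, ComputablePred p ∧ ∀ φ ∈ L, (p φ ↔ S φ)

end OneDim

/-! The halting problem for `Turing.ToPartrec.Code` reduces to satisfiability by sentences that use
only `rel`, equality and unary symbols. Since neither `succ` nor `less` occurs in them, the order of
a word plays no role: every finite non-empty structure can be ordered into a word, and every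
countably infinite one into an ω-word. One family of sentences therefore serves both signatures.

A model is a heap. Its elements are configurations, continuations, lists and numbers; unary labels
record the sort and the outermost constructor of an element. The single relation `rel` provides all
pointers, because the sort of the target tells which component is meant. The axioms make each kind
of pointer functional, which takes a universal sentence with three variables, allowed because a
block may bind all free variables. Each evaluation rule says that a configuration with a given label
has neighbours arranged as the next configuration requires. In such a rule the existential block may
leave only one variable free, so premise and conclusion share only the variable `0`. The conclusion
fetches the continuation and the list again, and functionality identifies them with the old ones.

Soundness is `Interp.IsRun.exists_step`: an element representing a configuration points to one
representing its successor, so a model contains the whole run of the evaluator. The successor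
pointer is injective on configurations and never hits the initial one, so a run that never halts
would embed `ℕ` into the model. Hence a finite model of `runs` forces halting. A model of
`diverges`, where halting labels are forbidden, forces divergence. Conversely, `runInterp` realises
the run on a set of genuine data given by `exists_supports`, finite if finitely many times are kept
and countable in general.

So satisfiability of `runs c n` over words is halting of `c` on `n`, and satisfiability of `diverges
c n` over ω-words is its complement. For fixed `c` both sentences are primitive recursive in `n`,
and some `c` has an undecidable halting set. -/

namespace OneDim

/-! ### Closure properties of the one-dimensional fragment. -/

namespace Formula

/-- Conjunction. -/
def and (φ ψ : Formula) : Formula := neg (or (neg φ) (neg ψ))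

/-- The conjunction of a list of formulas, ending in `χ`. -/
def conj (l : List Formula) (χ : Formula) : Formula := l.foldr and χ

/-- Bind all free variables but `x` existentially. -/
noncomputable def exBut (x : ℕ) (φ : Formula) : Formula :=
  exBlock (φ.freeVars.erase x).toList φ

/-- The universal closure. -/
noncomputable def all (φ : Formula) : Formula :=
  neg (exBlock φ.freeVars.toList (neg φ))

theorem freeVars_and (φ ψ : Formula) : (and φ ψ).freeVars = φ.freeVars ∪ ψ.freeVars := rfl

theorem freeVars_exBlock (xs : List ℕ) (φ : Formula) :
    (exBlock xs φ).freeVars = φ.freeVars \ xs.toFinset := by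
  induction xs with
  | nil => simp [exBlock]
  | cons x xs ih =>
    change ((exBlock xs φ).freeVars).erase x = _
    rw [ih]
    ext y
    simp
    tauto

theorem freeVars_exBut (x : ℕ) (φ : Formula) : (exBut x φ).freeVars ⊆ {x} := by
  intro y
  simp [exBut, freeVars_exBlock]
  tauto

theorem freeVars_all (φ : Formula) : (all φ).freeVars = ∅ := by
  simp [all, freeVars, freeVars_exBlock]

variable {σ : Set BinSym}

theorem IsOneDim.and {φ ψ : Formula} (h : IsOneDim σ φ) (h' : IsOneDim σ ψ) :
    IsOneDim σ (φ.and ψ) :=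
  .neg _ (.or _ _ (.neg _ h) (.neg _ h'))

theorem IsOneDim.conj {l : List Formula} {χ : Formula} (h : ∀ φ ∈ l, IsOneDim σ φ)
    (h' : IsOneDim σ χ) : IsOneDim σ (conj l χ) := by
  induction l with
  | nil => exact h'
  | cons φ l ih =>
    exact (h φ (by simp)).and (ih fun ψ hψ => h ψ (by simp [hψ]))

theorem freeVars_conj {l : List Formula} {χ : Formula} (h : ∀ φ ∈ l, φ.freeVars = ∅)
    (h' : χ.freeVars = ∅) : (conj l χ).freeVars = ∅ := by
  induction l with
  | nil => exact h'
  | cons φ l ih =>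
    change φ.freeVars ∪ (Formula.conj l χ).freeVars = ∅
    rw [h φ (by simp), ih fun ψ hψ => h ψ (by simp [hψ])]
    rfl

theorem IsOneDim.exBlock_freeVars {φ : Formula} (h : IsOneDim σ φ) :
    IsOneDim σ (exBlock φ.freeVars.toList φ) := by
  rcases hl : φ.freeVars.toList with _ | ⟨x, xs⟩
  · exact h
  · exact .exAll x xs φ h (hl ▸ φ.freeVars.nodup_toList) (by rw [← hl, Finset.toList_toFinset])

theorem IsOneDim.exBut {φ : Formula} (x : ℕ) (h : IsOneDim σ φ) : IsOneDim σ (exBut x φ) := by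
  by_cases hx : x ∈ φ.freeVars
  · refine .exAllButOne x _ φ h ?_ ?_
    · simp [Finset.nodup_toList]
    · simp [hx]
  · rw [Formula.exBut, Finset.erase_eq_of_notMem hx]
    exact h.exBlock_freeVars

theorem IsOneDim.all {φ : Formula} (h : IsOneDim σ φ) : IsOneDim σ (all φ) :=
  .neg _ (IsOneDim.exBlock_freeVars (.neg _ h))

/-! ### Computability of the connectives on Gödel numbers. -/

theorem primrec_neg : Primrec neg :=
  Primrec.encode_iff.1 <| (Primrec.nat_add.comp (Primrec.nat_mul.comp (Primrec.const 8)
    Primrec.encode) (Primrec.const 6)).of_eq fun _ => rfl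

theorem primrec_or : Primrec₂ or :=
  Primrec₂.encode_iff.1 <| (Primrec.nat_add.comp (Primrec.nat_mul.comp (Primrec.const 8)
    (Primrec₂.natPair.comp (Primrec.encode.comp Primrec.fst) (Primrec.encode.comp Primrec.snd)))
      (Primrec.const 5)).of_eq fun _ => rfl

theorem primrec_ex (x : ℕ) : Primrec (ex x) :=
  Primrec.encode_iff.1 <| (Primrec.nat_add.comp (Primrec.nat_mul.comp (Primrec.const 8)
    (Primrec₂.natPair.comp (Primrec.const x) Primrec.encode)) (Primrec.const 7)).of_eq fun _ => rfl

theorem primrec_and : Primrec₂ and :=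
  primrec_neg.comp (primrec_or.comp (primrec_neg.comp Primrec.fst) (primrec_neg.comp Primrec.snd))

end Formula

/-! ### Semantics of blocks of quantifiers. -/

namespace Interp

open Formula

variable {M : Type} (I : Interp M)

theorem holds_congr {φ : Formula} {v w : ℕ → M} (h : ∀ x ∈ φ.freeVars, v x = w x) :
    I.Holds v φ ↔ I.Holds w φ := by
  induction φ generalizing v w with
  | unary p x => simp_all [Holds, freeVars]
  | bin s x y => simp_all [Holds, freeVars]
  | eq x y => simp_all [Holds, freeVars]
  | or φ ψ ihφ ihψ =>
    exact or_congr (ihφ fun x hx => h x (Finset.mem_union_left _ hx))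
      (ihψ fun x hx => h x (Finset.mem_union_right _ hx))
  | neg φ ih => exact not_congr (ih h)
  | ex x φ ih =>
    refine exists_congr fun a => ih fun y hy => ?_
    by_cases hyx : y = x
    · simp [hyx]
    · simpa [hyx] using h y (Finset.mem_erase.2 ⟨hyx, hy⟩)

@[simp]
theorem holds_and (v : ℕ → M) (φ ψ : Formula) :
    I.Holds v (φ.and ψ) ↔ I.Holds v φ ∧ I.Holds v ψ := by
  simp [Formula.and, Holds, not_or]

theorem holds_conj (v : ℕ → M) (l : List Formula) (χ : Formula) :
    I.Holds v (conj l χ) ↔ (∀ φ ∈ l, I.Holds v φ) ∧ I.Holds v χ := by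
  induction l with
  | nil => simp [conj]
  | cons φ l ih =>
    change I.Holds v (φ.and (conj l χ)) ↔ _
    simp [ih, and_assoc]

theorem holds_exBlock (v : ℕ → M) (xs : List ℕ) (φ : Formula) :
    I.Holds v (exBlock xs φ) ↔ ∃ w : ℕ → M, (∀ y ∉ xs, w y = v y) ∧ I.Holds w φ := by
  induction xs generalizing v with
  | nil =>
    refine ⟨fun h => ⟨v, fun _ _ => rfl, h⟩, ?_⟩
    rintro ⟨w, hw, h⟩
    rwa [show w = v from funext fun y => hw y (by simp)] at h
  | cons x xs ih =>
    change (∃ a : M, I.Holds (Function.update v x a) (exBlock xs φ)) ↔ _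
    simp only [ih]
    constructor
    · rintro ⟨a, w, hw, h⟩
      refine ⟨w, fun y hy => ?_, h⟩
      rw [List.mem_cons, not_or] at hy
      rw [hw y hy.2, Function.update_of_ne hy.1]
    · rintro ⟨w, hw, h⟩
      refine ⟨w x, w, fun y hy => ?_, h⟩
      by_cases hyx : y = x
      · simp [hyx]
      · rw [Function.update_of_ne hyx, hw y (by simp [hyx, hy])]

-- Only the value at `x` is retained: the remaining free variables are bound by the block, and the
-- values of non-free variables do not matter.
@[simp]
theorem holds_exBut (v : ℕ → M) (x : ℕ) (φ : Formula) :
    I.Holds v (exBut x φ) ↔ ∃ w : ℕ → M, w x = v x ∧ I.Holds w φ := by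
  rw [exBut, holds_exBlock]
  constructor
  · rintro ⟨w, hw, h⟩
    exact ⟨w, hw x (by simp), h⟩
  · rintro ⟨w, hw, h⟩
    classical
    -- The block leaves non-free variables untouched, so `w` is reset to `v` there.
    refine ⟨fun y => if y ∈ φ.freeVars then w y else v y, fun y hy => ?_, ?_⟩
    · by_cases hyx : y = x
      · simp [hyx, hw]
      · simp_all
    · refine (I.holds_congr fun y hy => ?_).1 h
      simp [hy]

@[simp]
theorem holds_all (v : ℕ → M) (φ : Formula) :
    I.Holds v (all φ) ↔ ∀ w : ℕ → M, I.Holds w φ := by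
  rw [all, Holds, holds_exBlock]
  constructor
  · intro h w
    by_contra hw
    classical
    refine h ⟨fun y => if y ∈ φ.freeVars then w y else v y, fun y hy => by simp_all, fun h' => ?_⟩
    refine hw ((I.holds_congr fun y hy => ?_).1 h')
    simp [hy]
  · rintro h ⟨w, -, hw⟩
    exact hw (h w)

end Interp

/-! ### A small-step evaluator and the halting problem. -/

open Turing.ToPartrec StateTransition

/-- Configurations of a small-step evaluator for `Turing.ToPartrec.Code`: evaluate a code on a
list, return a list to a continuation, or halt. -/
inductive Config : Type
  | norm : Code → Cont → List ℕ → Config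
  | ret : Cont → List ℕ → Config
  | halt : List ℕ → Config

namespace Config

/-- One step of the evaluator. -/
def step : Config → Option Config
  | norm .zero' k v => some (ret k (0 :: v))
  | norm .succ k v => some (ret k [v.headI.succ])
  | norm .tail k v => some (ret k v.tail)
  | norm (.cons f fs) k v => some (norm f (.cons₁ fs v k) v)
  | norm (.comp f g) k v => some (norm g (.comp f k) v)
  | norm (.case f g) k v =>
    some (v.headI.rec (norm f k v.tail) fun y _ => norm g k (y :: v.tail))
  | norm (.fix f) k v => some (norm f (.fix f k) v)
  | ret .halt v => some (halt v)
  | ret (.cons₁ fs as k) v => some (norm fs (.cons₂ v k) as)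
  | ret (.cons₂ ns k) v => some (ret k (ns.headI :: v))
  | ret (.comp f k) v => some (norm f k v)
  | ret (.fix f k) v => some (if v.headI = 0 then ret k v.tail else norm f (.fix f k) v.tail)
  | halt _ => none

theorem step_eq_none {c : Config} : c.step = none ↔ ∃ v, c = halt v := by
  constructor
  · intro h
    match c with
    | halt v => exact ⟨v, rfl⟩
    | norm c k v => cases c <;> simp [step] at h
    | ret k v => cases k <;> simp [step] at h
  · rintro ⟨v, rfl⟩
    rfl

/-- Configurations of the big-step evaluator, as configurations of the small-step one. -/
def ofCfg : Cfg → Config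
  | .halt v => halt v
  | .ret k v => ret k v

/-- `stepNormal` recurses through the code within one step. The small-step evaluator unfolds this
recursion, so that each of its steps changes only boundedly many constructors and can be described
by one local rule. -/
theorem reaches_stepNormal (c : Code) (k : Cont) (v : List ℕ) :
    Reaches₁ step (norm c k v) (ofCfg (stepNormal c k v)) := by
  induction c generalizing k v with
  | zero' => exact .single rfl
  | succ => exact .single rfl
  | tail => exact .single rfl
  | cons f fs ihf _ => exact .head rfl (ihf _ _)
  | comp f g _ ihg => exact .head rfl (ihg _ _)
  | case f g ihf ihg =>
    dsimp only [stepNormal]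
    rcases h : v.headI with _ | y
    · exact .head (b := norm f k v.tail) (by simp [step, h]) (ihf _ _)
    · exact .head (b := norm g k (y :: v.tail)) (by simp [step, h]) (ihg _ _)
  | fix f ih => exact .head rfl (ih _ _)

theorem reaches_stepRet (k : Cont) (v : List ℕ) :
    Reaches₁ step (ret k v) (ofCfg (stepRet k v)) := by
  induction k generalizing v with
  | halt => exact .single rfl
  | cons₁ fs as k _ => exact .head rfl (reaches_stepNormal _ _ _)
  | cons₂ ns k ih => exact .head rfl (ih _)
  | comp f k _ => exact .head rfl (reaches_stepNormal _ _ _)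
  | fix f k ih =>
    rw [stepRet]
    split_ifs with h
    · exact .head (b := ret k v.tail) (by simp [step, h]) (ih _)
    · exact .head (b := norm f (.fix f k) v.tail) (by simp [step, h]) (reaches_stepNormal _ _ _)

/-- Every big step is simulated by at least one small step, which is what transfers termination
between the two evaluators. -/
theorem respects_ofCfg :
    Respects Turing.ToPartrec.step step fun a b => ofCfg a = b := by
  rintro (v | ⟨k, v⟩) _ rfl
  · rfl
  · exact ⟨_, rfl, reaches_stepRet k v⟩

theorem eval_step_dom (c : Code) (v : List ℕ) :
    (eval step (norm c .halt v)).Dom ↔ (c.eval v).Dom := by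
  rw [reaches_eval (reaches_stepNormal c .halt v).to_reflTransGen, tr_eval_dom respects_ofCfg rfl,
    stepNormal_eval]
  rfl

/-- The run of the evaluator from a configuration; it remains in a halting configuration. -/
def run (c : Config) : ℕ → Config
  | 0 => c
  | i + 1 => ((run c i).step).getD (run c i)

theorem run_succ {c d : Config} {i : ℕ} (h : (run c i).step = some d) : run c (i + 1) = d := by
  simp [run, h]

theorem eval_dom_iff (c : Config) : (eval step c).Dom ↔ ∃ i, (run c i).step = none := by
  constructor
  · intro h
    obtain ⟨hr, hn⟩ := mem_eval.1 ⟨h, rfl⟩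
    generalize (eval step c).get h = d at hr hn
    suffices ∃ i, run c i = d by
      obtain ⟨i, rfl⟩ := this
      exact ⟨i, hn⟩
    clear hn
    induction hr with
    | refl => exact ⟨0, rfl⟩
    | tail _ hs ih =>
      obtain ⟨i, rfl⟩ := ih
      exact ⟨i + 1, run_succ hs⟩
  · rintro ⟨i, hi⟩
    refine Part.dom_iff_mem.2 ⟨run c i, mem_eval.2 ⟨?_, hi⟩⟩
    clear hi
    induction i with
    | zero => exact .refl
    | succ i ih =>
      rcases h : (run c i).step with _ | d
      · rwa [run, h]
      · exact ih.tail (by rw [run_succ h]; exact h)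

end Config

/-- A single code suffices if it computes the universal function `n ↦` (value at `0` of the program
numbered `n`). Fixing it leaves only finitely many rules and makes the input the only varying part
of the sentence. -/
theorem exists_code_not_computable :
    ∃ c : Code, ¬ ComputablePred fun n : ℕ => (c.eval [n]).Dom := by
  have hu : Partrec fun n : ℕ => (Denumerable.ofNat Nat.Partrec.Code n).eval 0 :=
    Nat.Partrec.Code.eval_part.comp (Computable.ofNat _) (Computable.const 0)
  obtain ⟨c, hc⟩ := Code.exists_code (Nat.Partrec'.part_iff₁.2 hu)
  refine ⟨c, fun h => ComputablePred.halting_problem 0 ?_⟩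
  refine ComputablePred.computable_of_manyOneReducible ⟨Encodable.encode, Computable.encode, ?_⟩ h
  intro d
  have := hc ⟨[Encodable.encode d], rfl⟩
  dsimp only at this
  rw [this]
  simp [List.Vector.head]

/-! ### Unary symbols as labels. -/

/-- An injection of codes into formulas, a type with a Gödel numbering. -/
def codeFormula : Code → Formula
  | .zero' => .eq 0 0
  | .succ => .eq 0 1
  | .tail => .eq 0 2
  | .cons f g => .or (codeFormula f) (codeFormula g)
  | .comp f g => .neg (.or (codeFormula f) (codeFormula g))
  | .case f g => .neg (.neg (.or (codeFormula f) (codeFormula g)))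
  | .fix f => .ex 0 (codeFormula f)

theorem codeFormula_injective : Function.Injective codeFormula := by
  intro c
  induction c with
  | zero' => rintro (_ | _) h <;> simp_all [codeFormula]
  | succ => rintro (_ | _) h <;> simp_all [codeFormula]
  | tail => rintro (_ | _) h <;> simp_all [codeFormula]
  | cons f g ihf ihg =>
    rintro (_ | _) h <;> simp [codeFormula] at h
    rw [ihf h.1, ihg h.2]
  | comp f g ihf ihg =>
    rintro (_ | _) h <;> simp [codeFormula] at h
    rw [ihf h.1, ihg h.2]
  | case f g ihf ihg =>
    rintro (_ | _) h <;> simp [codeFormula] at h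
    rw [ihf h.1, ihg h.2]
  | fix f ih =>
    rintro (_ | _) h <;> simp [codeFormula] at h
    rw [ih h]

/-- The sorts of elements in a structure that encodes a run of the evaluator. -/
inductive Kind : Type
  | config | cont | list | nat

/-- Labels of elements: their sort, a mark for the initial configuration, and the outermost
constructors of configurations, continuations, lists and numbers. -/
inductive Label : Type
  | kind : Kind → Label
  | first : Label
  | norm : Code → Label
  | ret : Label
  | halt : Label
  | contHalt : Label
  | contCons₁ : Code → Label
  | contCons₂ : Label
  | contComp : Code → Label
  | contFix : Code → Label
  | nil : Label
  | cons : Label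
  | zero : Label
  | succ : Label

/-- An injection of labels into formulas. -/
def Label.formula : Label → Formula
  | kind .config => .eq 0 0
  | kind .cont => .eq 0 1
  | kind .list => .eq 0 2
  | kind .nat => .eq 0 3
  | first => .eq 1 0
  | ret => .eq 1 1
  | halt => .eq 1 2
  | contHalt => .eq 1 3
  | contCons₂ => .eq 1 4
  | nil => .eq 1 5
  | cons => .eq 1 6
  | zero => .eq 1 7
  | succ => .eq 1 8
  | norm c => .or (.eq 0 0) (codeFormula c)
  | contCons₁ c => .or (.eq 0 1) (codeFormula c)
  | contComp c => .or (.eq 0 2) (codeFormula c)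
  | contFix c => .or (.eq 0 3) (codeFormula c)

theorem Label.formula_injective : Function.Injective Label.formula := by
  rintro (⟨_ | _⟩ | _) (⟨_ | _⟩ | _) h <;>
    simp_all [formula, codeFormula_injective.eq_iff]

/-- The unary symbol for a label. -/
def Label.symbol (l : Label) : ℕ := l.formula.toNat

theorem Label.symbol_injective : Function.Injective Label.symbol :=
  Formula.toNat_injective.comp formula_injective

/-! ### The sentences describing a run, and their membership in the fragment. -/

namespace Formula

/-- `x` carries the label `l`. -/
noncomputable def lab (l : Label) (x : ℕ) : Formula := unary l.symbol x

/-- `y` is the component of sort `s` of `x`. -/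
noncomputable def ptr (s : Kind) (x y : ℕ) : Formula := and (bin .rel x y) (lab (.kind s) y)

/-- `y` is the head of the list `x`, or zero if `x` is empty. -/
noncomputable def head (x y : ℕ) : Formula :=
  or (and (lab .nil x) (lab .zero y)) (and (lab .cons x) (ptr .nat x y))

/-- `y` is the tail of the list `x`. -/
noncomputable def tail (x y : ℕ) : Formula :=
  or (and (lab .nil x) (lab .nil y)) (and (lab .cons x) (ptr .list x y))

/-- The variable `0` is a configuration with successor `1`, continuation `2` and list `3`. -/
noncomputable def frame : Formula := conj [ptr .config 0 1, ptr .cont 0 2] (ptr .list 0 3)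

/-- What a configuration that evaluates a given code has to satisfy. -/
noncomputable def normBody : Code → Formula
  | .zero' => conj [frame, lab .ret 1, ptr .cont 1 2, ptr .list 1 4, lab .cons 4, ptr .list 4 3,
      ptr .nat 4 5] (lab .zero 5)
  | .succ => conj [frame, lab .ret 1, ptr .cont 1 2, ptr .list 1 4, lab .cons 4, ptr .nat 4 5,
      lab .succ 5, ptr .nat 5 6, head 3 6, ptr .list 4 7] (lab .nil 7)
  | .tail => conj [frame, lab .ret 1, ptr .cont 1 2, ptr .list 1 4] (tail 3 4)
  | .cons f fs => conj [frame, lab (.norm f) 1, ptr .list 1 3, ptr .cont 1 4,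
      lab (.contCons₁ fs) 4, ptr .list 4 3] (ptr .cont 4 2)
  | .comp f g => conj [frame, lab (.norm g) 1, ptr .list 1 3, ptr .cont 1 4,
      lab (.contComp f) 4] (ptr .cont 4 2)
  | .case f g => conj [frame, ptr .cont 1 2, ptr .list 1 4, head 3 5]
      (or (conj [lab .zero 5, lab (.norm f) 1] (tail 3 4))
        (conj [lab .succ 5, lab (.norm g) 1, lab .cons 4, tail 3 6, ptr .list 4 6, ptr .nat 5 7]
          (ptr .nat 4 7)))
  | .fix f => conj [frame, lab (.norm f) 1, ptr .list 1 3, ptr .cont 1 4,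
      lab (.contFix f) 4] (ptr .cont 4 2)

/-- If `φ` holds then `ψ` holds for the same value of the variable `0` and suitable values
of the others. -/
noncomputable def rule (φ ψ : Formula) : Formula := all (or (neg φ) (exBut 0 ψ))

/-- The rule for configurations that evaluate `c`. -/
noncomputable def normRule (c : Code) : Formula := rule (lab (.norm c) 0) (normBody c)

/-- The rule for configurations that return to a continuation with the label `l`. -/
noncomputable def retRule (l : Label) (ψ : Formula) : Formula :=
  rule (conj [lab .ret 0, ptr .cont 0 2] (lab l 2)) (and frame ψ)

/-- The rule for returning to the empty continuation. -/
noncomputable def haltRule : Formula := retRule .contHalt (lab .halt 1)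

/-- The rule for returning to the continuation `cons₁`. -/
noncomputable def cons₁Rule (f : Code) : Formula :=
  retRule (.contCons₁ f) <| conj [ptr .cont 2 4, ptr .list 2 5, lab (.norm f) 1, ptr .list 1 5,
    ptr .cont 1 6, lab .contCons₂ 6, ptr .list 6 3] (ptr .cont 6 4)

/-- The rule for returning to the continuation `cons₂`. -/
noncomputable def cons₂Rule : Formula :=
  retRule .contCons₂ <| conj [ptr .cont 2 4, ptr .list 2 5, lab .ret 1, ptr .cont 1 4,
    ptr .list 1 6, lab .cons 6, ptr .nat 6 7, head 5 7] (ptr .list 6 3)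

/-- The rule for returning to the continuation `comp`. -/
noncomputable def compRule (f : Code) : Formula :=
  retRule (.contComp f) <| conj [ptr .cont 2 4, lab (.norm f) 1, ptr .cont 1 4] (ptr .list 1 3)

/-- The rule for returning to the continuation `fix`. -/
noncomputable def fixRule (f : Code) : Formula :=
  retRule (.contFix f) <| conj [ptr .cont 2 4, head 3 5, ptr .list 1 6, tail 3 6]
    (or (conj [lab .zero 5, lab .ret 1] (ptr .cont 1 4))
      (conj [lab .succ 5, lab (.norm f) 1] (ptr .cont 1 2)))

/-- Components are unique. -/
noncomputable def functional (s : Kind) : Formula :=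
  all (or (neg (and (ptr s 0 1) (ptr s 0 2))) (eq 1 2))

/-- No element carries both labels. -/
noncomputable def exclusive (l l' : Label) : Formula := all (neg (and (lab l 0) (lab l' 0)))

/-- The successor of configurations is injective. -/
noncomputable def injective : Formula :=
  all (or (neg (conj [lab (.kind .config) 0, lab (.kind .config) 1, ptr .config 0 2]
    (ptr .config 1 2))) (eq 0 1))

/-- The initial configuration is not a successor. -/
noncomputable def initial : Formula :=
  all (neg (conj [lab (.kind .config) 0, lab .first 1] (ptr .config 0 1)))

/-- The axioms for runs of the evaluator in which only codes from `L` occur. -/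
noncomputable def runAxioms (L : List Code) : List Formula :=
  [functional .config, functional .cont, functional .list, functional .nat, exclusive .nil .cons,
    exclusive .zero .succ, injective, initial, haltRule, cons₂Rule] ++
  (L.map normRule ++ L.map cons₁Rule ++ L.map compRule ++ L.map fixRule)

/-- The variable `0` is the number `n`. -/
noncomputable def numeral : ℕ → Formula
  | 0 => lab .zero 0
  | n + 1 => and (lab .succ 0) (ex 1 (and (ptr .nat 0 1) (ex 0 (and (eq 0 1) (numeral n)))))

/-- The variable `0` is the input of the initial configuration, which evaluates `c`. -/
noncomputable def input (c : Code) : Formula :=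
  exBut 0 (conj [lab .first 1, lab (.kind .config) 1, lab (.norm c) 1, ptr .cont 1 2,
    lab .contHalt 2, ptr .list 1 3, lab .cons 3, ptr .nat 3 0, ptr .list 3 4] (lab .nil 4))

/-- The initial configuration evaluates `c` on `n`. -/
noncomputable def start (c : Code) (n : ℕ) : Formula := ex 0 (and (numeral n) (input c))

/-- The list of the codes that occur in a code. -/
def codes : Code → List Code
  | .zero' => [.zero']
  | .succ => [.succ]
  | .tail => [.tail]
  | .cons f g => .cons f g :: (codes f ++ codes g)
  | .comp f g => .comp f g :: (codes f ++ codes g)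
  | .case f g => .case f g :: (codes f ++ codes g)
  | .fix f => .fix f :: codes f

/-- There is a run of `c` on `n`. -/
noncomputable def runs (c : Code) (n : ℕ) : Formula :=
  and (start c n) (conj (runAxioms (codes c)) haltRule)

/-- No configuration is halting. -/
noncomputable def noHalt : Formula := all (neg (lab .halt 0))

/-- There is a run of `c` on `n` that does not halt. -/
noncomputable def diverges (c : Code) (n : ℕ) : Formula := and (runs c n) noHalt

theorem mem_codes (c : Code) : c ∈ codes c := by
  cases c <;> simp [codes]

theorem freeVars_numeral (n : ℕ) : (numeral n).freeVars = {0} := by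
  induction n with
  | zero => rfl
  | succ n ih => simp only [numeral, freeVars_and, lab, ptr, freeVars, ih]; decide

theorem freeVars_start (c : Code) (n : ℕ) : (start c n).freeVars = ∅ := by
  have := freeVars_exBut 0 (conj [lab .first 1, lab (.kind .config) 1, lab (.norm c) 1,
    ptr .cont 1 2, lab .contHalt 2, ptr .list 1 3, lab .cons 3, ptr .nat 3 0, ptr .list 3 4]
    (lab .nil 4))
  simp only [start, freeVars, freeVars_and, freeVars_numeral, input]
  rwa [Finset.erase_eq_empty_iff, or_iff_right (by simp), Finset.union_eq_left.2]

variable {σ : Set BinSym}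

theorem isOneDim_lab (l : Label) (x : ℕ) : IsOneDim σ (lab l x) := .unary _ _

theorem isOneDim_ptr (hσ : BinSym.rel ∈ σ) (s : Kind) (x y : ℕ) : IsOneDim σ (ptr s x y) :=
  .and (.bin _ hσ _ _) (.unary _ _)

theorem isOneDim_head (hσ : BinSym.rel ∈ σ) (x y : ℕ) : IsOneDim σ (head x y) :=
  .or _ _ (.and (.unary _ _) (.unary _ _)) (.and (.unary _ _) (isOneDim_ptr hσ _ _ _))

theorem isOneDim_tail (hσ : BinSym.rel ∈ σ) (x y : ℕ) : IsOneDim σ (tail x y) :=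
  .or _ _ (.and (.unary _ _) (.unary _ _)) (.and (.unary _ _) (isOneDim_ptr hσ _ _ _))

theorem isOneDim_frame (hσ : BinSym.rel ∈ σ) : IsOneDim σ frame :=
  .conj (by simp [isOneDim_ptr hσ]) (isOneDim_ptr hσ _ _ _)

theorem isOneDim_normBody (hσ : BinSym.rel ∈ σ) (c : Code) : IsOneDim σ (normBody c) := by
  have := isOneDim_lab (σ := σ)
  have := isOneDim_ptr hσ
  have := isOneDim_head hσ
  have := isOneDim_tail hσ
  have := isOneDim_frame hσ
  cases c with
  | case f g =>
    exact .conj (by simp [*]) (.or _ _ (.conj (by simp [*]) (by simp [*]))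
      (.conj (by simp [*]) (by simp [*])))
  | _ => exact .conj (by simp [*]) (by simp [*])

theorem isOneDim_retRule (hσ : BinSym.rel ∈ σ) {l : Label} {ψ : Formula} (h : IsOneDim σ ψ) :
    IsOneDim σ (retRule l ψ) :=
  .all (.or _ _ (.neg _ (.conj (by simp [isOneDim_ptr hσ, isOneDim_lab]) (isOneDim_lab _ _)))
    (.exBut 0 (.and (isOneDim_frame hσ) h)))

theorem isOneDim_of_mem_runAxioms (hσ : BinSym.rel ∈ σ) {L : List Code} {φ : Formula}
    (h : φ ∈ runAxioms L) : IsOneDim σ φ := by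
  have hl := isOneDim_lab (σ := σ)
  have hp := isOneDim_ptr hσ
  have := isOneDim_head hσ
  have := isOneDim_tail hσ
  have hfun (s : Kind) : IsOneDim σ (functional s) :=
    .all (.or _ _ (.neg _ (.and (hp _ _ _) (hp _ _ _))) (.eq _ _))
  have hexc (l l' : Label) : IsOneDim σ (exclusive l l') :=
    .all (.neg _ (.and (hl _ _) (hl _ _)))
  simp only [runAxioms, List.mem_append, List.mem_cons, List.not_mem_nil, or_false,
    List.mem_map] at h
  rcases h with (rfl | rfl | rfl | rfl | rfl | rfl | rfl | rfl | rfl | rfl) |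
    (((⟨c, -, rfl⟩ | ⟨c, -, rfl⟩) | ⟨c, -, rfl⟩) | ⟨c, -, rfl⟩)
  · exact hfun _
  · exact hfun _
  · exact hfun _
  · exact hfun _
  · exact hexc _ _
  · exact hexc _ _
  · exact .all (.or _ _ (.neg _ (.conj (by simp [*]) (hp _ _ _))) (.eq _ _))
  · exact .all (.neg _ (.conj (by simp [*]) (hp _ _ _)))
  · exact isOneDim_retRule hσ (hl _ _)
  · exact isOneDim_retRule hσ (.conj (by simp [*]) (hp _ _ _))
  · exact .all (.or _ _ (.neg _ (hl _ _)) (.exBut 0 (isOneDim_normBody hσ c)))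
  · exact isOneDim_retRule hσ (.conj (by simp [*]) (hp _ _ _))
  · exact isOneDim_retRule hσ (.conj (by simp [*]) (hp _ _ _))
  · exact isOneDim_retRule hσ (.conj (by simp [*]) (.or _ _ (.conj (by simp [*]) (hp _ _ _))
      (.conj (by simp [*]) (hp _ _ _))))

theorem isOneDim_numeral (hσ : BinSym.rel ∈ σ) (n : ℕ) : IsOneDim σ (numeral n) := by
  induction n with
  | zero => exact isOneDim_lab _ _
  | succ n ih =>
    refine .and (isOneDim_lab _ _) (.exAllButOne 0 [1] _ (.and (isOneDim_ptr hσ _ _ _)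
      (.exAllButOne 1 [0] _ (.and (.eq _ _) ih) (by simp) ?_)) (by simp) ?_)
    · simp only [freeVars, freeVars_numeral]; decide
    · simp only [ptr, lab, freeVars_and, freeVars, freeVars_numeral]; decide

theorem isOneDim_start (hσ : BinSym.rel ∈ σ) (c : Code) (n : ℕ) : IsOneDim σ (start c n) := by
  refine .exAll 0 [] _ (.and (isOneDim_numeral hσ n)
    (.exBut 0 (.conj ?_ (isOneDim_lab _ _)))) (by simp) ?_
  · simp [isOneDim_lab, isOneDim_ptr hσ]
  · change _ = (numeral n).freeVars ∪ (input c).freeVars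
    rw [freeVars_numeral]
    exact (Finset.union_eq_left.2 (freeVars_exBut _ _)).symm

theorem runs_mem (hσ : BinSym.rel ∈ σ) (c : Code) (n : ℕ) : runs c n ∈ oneDimSentences σ := by
  have hmem : haltRule ∈ runAxioms (codes c) := by simp [runAxioms]
  refine ⟨(isOneDim_start hσ c n).and (.conj (fun φ => isOneDim_of_mem_runAxioms hσ)
    (isOneDim_of_mem_runAxioms hσ hmem)), ?_⟩
  have hfree : ∀ φ ∈ runAxioms (codes c), φ.freeVars = ∅ := by
    intro φ h
    simp only [runAxioms, List.mem_append, List.mem_cons, List.not_mem_nil, or_false,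
      List.mem_map] at h
    rcases h with (rfl | rfl | rfl | rfl | rfl | rfl | rfl | rfl | rfl | rfl) |
      (((⟨c, -, rfl⟩ | ⟨c, -, rfl⟩) | ⟨c, -, rfl⟩) | ⟨c, -, rfl⟩) <;> exact freeVars_all _
  rw [runs, freeVars_and, freeVars_start, freeVars_conj hfree (hfree _ hmem)]
  rfl

theorem diverges_mem (hσ : BinSym.rel ∈ σ) (c : Code) (n : ℕ) :
    diverges c n ∈ oneDimSentences σ := by
  refine ⟨(runs_mem hσ c n).1.and (.all (.neg _ (isOneDim_lab _ _))), ?_⟩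
  rw [diverges, freeVars_and, (runs_mem hσ c n).2, noHalt, freeVars_all]
  rfl

/-- The numeral reuses the variables `0` and `1` at every depth, so it arises by iterating one fixed
operation on formulas. -/
theorem primrec_numeral : Primrec numeral := by
  have h : Primrec₂ fun (_ : ℕ) (φ : Formula) =>
      and (lab .succ 0) (ex 1 (and (ptr .nat 0 1) (ex 0 (and (eq 0 1) φ)))) :=
    primrec_and.comp (Primrec.const _) <| (primrec_ex 1).comp <|
      primrec_and.comp (Primrec.const _) <| (primrec_ex 0).comp <|
      primrec_and.comp (Primrec.const _) Primrec.snd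
  refine (Primrec.nat_rec₁ (lab .zero 0) h).of_eq fun n => ?_
  induction n with
  | zero => rfl
  | succ n ih => simp only [numeral, ← ih]

/-- Only the numeral depends on `n`; the axioms and the input formula are constants. -/
theorem primrec_runs (c : Code) : Primrec (runs c) :=
  primrec_and.comp ((primrec_ex 0).comp (primrec_and.comp primrec_numeral (Primrec.const _)))
    (Primrec.const _)

theorem primrec_diverges (c : Code) : Primrec (diverges c) :=
  primrec_and.comp (primrec_runs c) (Primrec.const _)

end Formula

/-! ### Soundness: models of the axioms contain the run. -/

open Formula

namespace Interp

variable {M : Type} (I : Interp M)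

/-- `a` carries the label `l`. -/
def Lab (l : Label) (a : M) : Prop := I.unary l.symbol a

/-- `b` is a component of sort `s` of `a`. -/
def Ptr (s : Kind) (a b : M) : Prop := I.bin .rel a b ∧ I.Lab (.kind s) b

@[simp]
theorem holds_lab (v : ℕ → M) (l : Label) (x : ℕ) : I.Holds v (lab l x) ↔ I.Lab l (v x) :=
  Iff.rfl

@[simp]
theorem holds_ptr (v : ℕ → M) (s : Kind) (x y : ℕ) :
    I.Holds v (ptr s x y) ↔ I.Ptr s (v x) (v y) :=
  I.holds_and _ _ _

@[simp]
theorem holds_or (v : ℕ → M) (φ ψ : Formula) :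
    I.Holds v (φ.or ψ) ↔ I.Holds v φ ∨ I.Holds v ψ :=
  Iff.rfl

@[simp]
theorem holds_neg (v : ℕ → M) (φ : Formula) : I.Holds v φ.neg ↔ ¬ I.Holds v φ :=
  Iff.rfl

@[simp]
theorem holds_eq (v : ℕ → M) (x y : ℕ) : I.Holds v (.eq x y) ↔ v x = v y :=
  Iff.rfl

theorem holds_rule (v : ℕ → M) (φ ψ : Formula) : I.Holds v (rule φ ψ) ↔
    ∀ w : ℕ → M, I.Holds w φ → ∃ w' : ℕ → M, w' 0 = w 0 ∧ I.Holds w' ψ := by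
  simp [rule, ← imp_iff_not_or]

theorem holds_normRule (v : ℕ → M) (c : Code) : I.Holds v (normRule c) ↔
    ∀ t, I.Lab (.norm c) t → ∃ w : ℕ → M, w 0 = t ∧ I.Holds w (normBody c) := by
  rw [normRule, holds_rule]
  exact ⟨fun h t => h fun _ => t, fun h w => h (w 0)⟩

theorem holds_retRule (v : ℕ → M) (l : Label) (ψ : Formula) : I.Holds v (retRule l ψ) ↔
    ∀ t k, I.Lab .ret t → I.Ptr .cont t k → I.Lab l k →
      ∃ w : ℕ → M, w 0 = t ∧ I.Holds w frame ∧ I.Holds w ψ := by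
  simp only [retRule, holds_rule, holds_conj, holds_and, List.forall_mem_cons, holds_lab,
    holds_ptr, List.not_mem_nil, false_imp_iff, implies_true, and_true, and_imp]
  exact ⟨fun h t k h₁ h₂ h₃ => h (fun | 0 => t | _ => k) h₁ h₂ h₃,
    fun h w => h (w 0) (w 2)⟩

/-- `a` represents a number. -/
def RepNat : ℕ → M → Prop
  | 0, a => I.Lab .zero a
  | n + 1, a => I.Lab .succ a ∧ ∃ b, I.Ptr .nat a b ∧ RepNat n b

/-- `a` represents a list of numbers. -/
def RepList : List ℕ → M → Prop
  | [], a => I.Lab .nil a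
  | n :: l, a => I.Lab .cons a ∧ (∃ b, I.Ptr .nat a b ∧ I.RepNat n b) ∧
      ∃ b, I.Ptr .list a b ∧ RepList l b

/-- `a` represents a continuation. -/
def RepCont : Cont → M → Prop
  | .halt, a => I.Lab .contHalt a
  | .cons₁ c v k, a => I.Lab (.contCons₁ c) a ∧ (∃ b, I.Ptr .list a b ∧ I.RepList v b) ∧
      ∃ b, I.Ptr .cont a b ∧ RepCont k b
  | .cons₂ v k, a => I.Lab .contCons₂ a ∧ (∃ b, I.Ptr .list a b ∧ I.RepList v b) ∧
      ∃ b, I.Ptr .cont a b ∧ RepCont k b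
  | .comp c k, a => I.Lab (.contComp c) a ∧ ∃ b, I.Ptr .cont a b ∧ RepCont k b
  | .fix c k, a => I.Lab (.contFix c) a ∧ ∃ b, I.Ptr .cont a b ∧ RepCont k b

/-- `a` represents a configuration. -/
def RepConfig : Config → M → Prop
  | .norm c k v, a => I.Lab (.norm c) a ∧ (∃ b, I.Ptr .cont a b ∧ I.RepCont k b) ∧
      ∃ b, I.Ptr .list a b ∧ I.RepList v b
  | .ret k v, a => I.Lab .ret a ∧ (∃ b, I.Ptr .cont a b ∧ I.RepCont k b) ∧
      ∃ b, I.Ptr .list a b ∧ I.RepList v b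
  | .halt _, a => I.Lab .halt a

end Interp

/-- All codes in a continuation, and their subcodes, are in `L`. -/
def ContIn (L : List Code) : Cont → Prop
  | .halt => True
  | .cons₁ c _ k => codes c ⊆ L ∧ ContIn L k
  | .cons₂ _ k => ContIn L k
  | .comp c k => codes c ⊆ L ∧ ContIn L k
  | .fix c k => codes c ⊆ L ∧ ContIn L k

/-- All codes in a configuration, and their subcodes, are in `L`. -/
def Config.In (L : List Code) : Config → Prop
  | .norm c k _ => codes c ⊆ L ∧ ContIn L k
  | .ret k _ => ContIn L k
  | .halt _ => True

/-- The evaluator only ever handles subcodes of the initial code, which is why finitely many rules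
cover the entire run. -/
theorem Config.In.step {L : List Code} {c d : Config} (hc : c.In L) (h : c.step = some d) :
    d.In L := by
  match c with
  | .norm c k v =>
    cases c with
    | case f g =>
      obtain rfl := Option.some.inj h
      rcases v.headI with _ | y <;>
        simp_all [Config.In, codes, List.cons_subset, List.append_subset]
    | _ =>
      obtain rfl := Option.some.inj h
      simp_all [Config.In, ContIn, codes, List.cons_subset, List.append_subset]
  | .ret k v =>
    cases k with
    | fix f k =>
      obtain rfl := Option.some.inj h
      split_ifs <;> simp_all [Config.In, ContIn]
    | _ =>
      obtain rfl := Option.some.inj h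
      simp_all [Config.In, ContIn]
  | .halt v => cases h

/-- `I` satisfies the axioms for runs with codes in `L`. -/
structure Interp.IsRun {M : Type} (I : Interp M) (L : List Code) : Prop where
  functional : ∀ s a b c, I.Ptr s a b → I.Ptr s a c → b = c
  nil_cons : ∀ a, ¬ (I.Lab .nil a ∧ I.Lab .cons a)
  zero_succ : ∀ a, ¬ (I.Lab .zero a ∧ I.Lab .succ a)
  injective : ∀ a b c, I.Lab (.kind .config) a → I.Lab (.kind .config) b →
    I.Ptr .config a c → I.Ptr .config b c → a = b
  initial : ∀ a b, I.Lab (.kind .config) a → I.Lab .first b → ¬ I.Ptr .config a b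
  rules : ∀ v, I.Holds v haltRule ∧ I.Holds v cons₂Rule ∧ ∀ c ∈ L, I.Holds v (normRule c) ∧
    I.Holds v (cons₁Rule c) ∧ I.Holds v (compRule c) ∧ I.Holds v (fixRule c)

namespace Interp

variable {M : Type} {I : Interp M} {L : List Code}

theorem holds_functional (v : ℕ → M) (s : Kind) : I.Holds v (Formula.functional s) ↔
    ∀ a b c, I.Ptr s a b → I.Ptr s a c → b = c := by
  simp only [Formula.functional, holds_all, holds_or, holds_neg, holds_and, holds_ptr, holds_eq,
    ← imp_iff_not_or, and_imp]
  exact ⟨fun h a b c => h (fun | 0 => a | 1 => b | _ => c), fun h w => h _ _ _⟩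

theorem holds_exclusive (v : ℕ → M) (l l' : Label) : I.Holds v (exclusive l l') ↔
    ∀ a, ¬ (I.Lab l a ∧ I.Lab l' a) := by
  simp only [exclusive, holds_all, holds_neg, holds_and, holds_lab]
  exact ⟨fun h a => h fun _ => a, fun h w => h _⟩

theorem holds_injective (v : ℕ → M) : I.Holds v Formula.injective ↔
    ∀ a b c, I.Lab (.kind .config) a → I.Lab (.kind .config) b →
      I.Ptr .config a c → I.Ptr .config b c → a = b := by
  simp only [Formula.injective, holds_all, holds_or, holds_neg, holds_conj, holds_ptr, holds_lab,
    holds_eq, ← imp_iff_not_or, List.forall_mem_cons, List.not_mem_nil, false_imp_iff,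
    implies_true, and_true, and_imp]
  exact ⟨fun h a b c => h (fun | 0 => a | 1 => b | _ => c), fun h w => h _ _ _⟩

theorem holds_initial (v : ℕ → M) : I.Holds v Formula.initial ↔
    ∀ a b, I.Lab (.kind .config) a → I.Lab .first b → ¬ I.Ptr .config a b := by
  simp only [Formula.initial, holds_all, holds_neg, holds_conj, holds_ptr, holds_lab,
    List.forall_mem_cons, List.not_mem_nil, false_imp_iff, implies_true, and_true, not_and, and_imp]
  exact ⟨fun h a b => h (fun | 0 => a | _ => b), fun h w => h _ _⟩

theorem isRun_iff [Nonempty M] :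
    I.IsRun L ↔ ∀ v : ℕ → M, ∀ φ ∈ runAxioms L, I.Holds v φ := by
  simp only [runAxioms, List.mem_append, or_imp, forall_and, List.forall_mem_cons,
    List.forall_mem_map, List.not_mem_nil, false_imp_iff, implies_true, and_true,
    holds_functional, holds_exclusive, holds_injective, holds_initial, forall_const]
  constructor
  · rintro ⟨h₁, h₂, h₃, h₄, h₅, h₆⟩
    exact ⟨⟨h₁ _, h₁ _, h₁ _, h₁ _, h₂, h₃, h₄, h₅, fun v => (h₆ v).1, fun v => (h₆ v).2.1⟩,
      ⟨⟨fun v c hc => ((h₆ v).2.2 c hc).1, fun v c hc => ((h₆ v).2.2 c hc).2.1⟩,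
        fun v c hc => ((h₆ v).2.2 c hc).2.2.1⟩, fun v c hc => ((h₆ v).2.2 c hc).2.2.2⟩
  · rintro ⟨⟨h₁, h₁', h₁'', h₁''', h₂, h₃, h₄, h₅, h₆, h₇⟩, ⟨⟨h₈, h₉⟩, h₁₀⟩, h₁₁⟩
    refine ⟨?_, h₂, h₃, h₄, h₅, fun v => ⟨h₆ v, h₇ v, fun c hc =>
      ⟨h₈ v c hc, h₉ v c hc, h₁₀ v c hc, h₁₁ v c hc⟩⟩⟩
    rintro (_ | _ | _ | _)
    exacts [h₁, h₁', h₁'', h₁''']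

/-- Exclusivity of `nil` and `cons` selects the right disjunct of `head`, and functionality makes
the element found there the represented head. The disjunct for the empty list matches the default
value `0` of `headI`. -/
theorem IsRun.repNat_headI (hI : I.IsRun L) {v : ℕ → M} {x y : ℕ} {l : List ℕ}
    (hl : I.RepList l (v x)) (h : I.Holds v (head x y)) : I.RepNat l.headI (v y) := by
  simp only [head, holds_or, holds_and, holds_lab, holds_ptr] at h
  cases l with
  | nil =>
    rcases h with h | h
    · exact h.2
    · exact absurd ⟨hl, h.1⟩ (hI.nil_cons _)
  | cons n l =>
    obtain ⟨h₁, ⟨b, hb, hn⟩, -⟩ := hl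
    rcases h with h | h
    · exact absurd ⟨h.1, h₁⟩ (hI.nil_cons _)
    · rwa [hI.functional _ _ _ _ h.2 hb]

theorem IsRun.repList_tail (hI : I.IsRun L) {v : ℕ → M} {x y : ℕ} {l : List ℕ}
    (hl : I.RepList l (v x)) (h : I.Holds v (tail x y)) : I.RepList l.tail (v y) := by
  simp only [tail, holds_or, holds_and, holds_lab, holds_ptr] at h
  cases l with
  | nil =>
    rcases h with h | h
    · exact h.2
    · exact absurd ⟨hl, h.1⟩ (hI.nil_cons _)
  | cons n l =>
    obtain ⟨h₁, -, ⟨b, hb, hn⟩⟩ := hl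
    rcases h with h | h
    · exact absurd ⟨h.1, h₁⟩ (hI.nil_cons _)
    · rwa [hI.functional _ _ _ _ h.2 hb]

/-- The rule for the label of `t` supplies neighbours of `t`, and functionality identifies the
continuation and list among them with those that witness `RepConfig c t`. Where the step branches on
a number, exclusivity of `zero` and `succ` rules out the wrong disjunct. -/
theorem IsRun.exists_step (hI : I.IsRun L) {c d : Config} {t : M} (hc : c.In L)
    (ht : I.RepConfig c t) (h : c.step = some d) :
    ∃ t', I.Ptr .config t t' ∧ I.RepConfig d t' := by
  have hfun := hI.functional
  obtain ⟨hHalt, hCons₂, hr⟩ := hI.rules fun _ => t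
  match c with
  | .norm c k v =>
    obtain ⟨hl, ⟨a, ha, hk⟩, ⟨b, hb, hv⟩⟩ := ht
    obtain ⟨w, rfl, hw⟩ := (holds_normRule _ _ _).1 (hr c (hc.1 (mem_codes c))).1 _ hl
    cases c <;> obtain rfl := Option.some.inj h <;>
      simp only [normBody, frame, holds_conj, List.forall_mem_cons, List.not_mem_nil,
        false_imp_iff, implies_true, and_true, holds_lab, holds_ptr] at hw <;>
      obtain ⟨⟨⟨⟨h₁, h₂⟩, h₃⟩, hw⟩, hw'⟩ := hw <;>
      obtain rfl := hfun _ _ _ _ h₂ ha <;> obtain rfl := hfun _ _ _ _ h₃ hb <;>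
      refine ⟨w 1, h₁, ?_⟩
    · obtain ⟨h₄, h₅, h₆, h₇, h₈, h₉⟩ := hw
      exact ⟨h₄, ⟨_, h₅, hk⟩, ⟨_, h₆, h₇, ⟨_, h₉, hw'⟩, ⟨_, h₈, hv⟩⟩⟩
    · obtain ⟨h₄, h₅, h₆, h₇, h₈, h₉, h₁₀, h₁₁, h₁₂⟩ := hw
      exact ⟨h₄, ⟨_, h₅, hk⟩, ⟨_, h₆, h₇, ⟨_, h₈, h₉, _, h₁₀, hI.repNat_headI hv h₁₁⟩,
        ⟨_, h₁₂, hw'⟩⟩⟩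
    · obtain ⟨h₄, h₅, h₆⟩ := hw
      exact ⟨h₄, ⟨_, h₅, hk⟩, ⟨_, h₆, hI.repList_tail hv hw'⟩⟩
    · obtain ⟨h₄, h₅, h₆, h₇, h₈⟩ := hw
      exact ⟨h₄, ⟨_, h₆, h₇, ⟨_, h₈, hv⟩, ⟨_, hw', hk⟩⟩, ⟨_, h₅, hv⟩⟩
    · obtain ⟨h₄, h₅, h₆, h₇⟩ := hw
      exact ⟨h₄, ⟨_, h₆, h₇, ⟨_, hw', hk⟩⟩, ⟨_, h₅, hv⟩⟩
    · obtain ⟨h₄, h₅, h₆⟩ := hw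
      have hn := hI.repNat_headI hv h₆
      rcases hy : v.headI with _ | y
      · rw [hy] at hn
        rcases hw' with hw' | hw' <;> simp only [holds_conj, List.forall_mem_cons,
          List.not_mem_nil, false_imp_iff, implies_true, and_true, holds_lab, holds_ptr] at hw'
        · exact ⟨hw'.1.2, ⟨_, h₄, hk⟩, ⟨_, h₅, hI.repList_tail hv hw'.2⟩⟩
        · exact absurd ⟨hn, hw'.1.1⟩ (hI.zero_succ _)
      · rw [hy] at hn
        obtain ⟨hs, b, hb, hn⟩ := hn
        rcases hw' with hw' | hw' <;> simp only [holds_conj, List.forall_mem_cons,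
          List.not_mem_nil, false_imp_iff, implies_true, and_true, holds_lab, holds_ptr] at hw'
        · exact absurd ⟨hw'.1.1, hs⟩ (hI.zero_succ _)
        · obtain ⟨⟨-, h₇, h₈, h₉, h₁₀, h₁₁⟩, h₁₂⟩ := hw'
          obtain rfl := hfun _ _ _ _ h₁₁ hb
          exact ⟨h₇, ⟨_, h₄, hk⟩, ⟨_, h₅, h₈, ⟨_, h₁₂, hn⟩, ⟨_, h₁₀, hI.repList_tail hv h₉⟩⟩⟩
    · obtain ⟨h₄, h₅, h₆, h₇⟩ := hw
      exact ⟨h₄, ⟨_, h₆, h₇, ⟨_, hw', hk⟩⟩, ⟨_, h₅, hv⟩⟩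
  | .ret k v =>
    obtain ⟨hl, ⟨a, ha, hk⟩, ⟨b, hb, hv⟩⟩ := ht
    have key {l : Label} {ψ : Formula} (hψ : I.Holds (fun _ => t) (retRule l ψ))
        (hla : I.Lab l a) : ∃ w : ℕ → M, w 0 = t ∧ w 2 = a ∧ w 3 = b ∧
          I.Ptr .config t (w 1) ∧ I.Holds w ψ := by
      obtain ⟨w, rfl, hw, hw'⟩ := (holds_retRule _ _ _ _).1 hψ _ _ hl ha hla
      simp only [frame, holds_conj, List.forall_mem_cons, List.not_mem_nil,
        false_imp_iff, implies_true, and_true, holds_ptr] at hw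
      exact ⟨w, rfl, hfun _ _ _ _ hw.1.2 ha, hfun _ _ _ _ hw.2 hb, hw.1.1, hw'⟩
    cases k <;> obtain rfl := Option.some.inj h
    · obtain ⟨w, -, -, -, h₁, h₂⟩ := key hHalt hk
      exact ⟨_, h₁, h₂⟩
    · obtain ⟨hla, ⟨p, hp, hvp⟩, ⟨q, hq, hkq⟩⟩ := hk
      obtain ⟨w, rfl, rfl, rfl, h₁, hw⟩ := key (hr _ (hc.1 (mem_codes _))).2.1 hla
      simp only [holds_conj, List.forall_mem_cons, List.not_mem_nil,
        false_imp_iff, implies_true, and_true, holds_lab, holds_ptr] at hw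
      obtain ⟨⟨h₂, h₃, h₄, h₅, h₆, h₇, h₈⟩, h₉⟩ := hw
      obtain rfl := hfun _ _ _ _ h₂ hq
      obtain rfl := hfun _ _ _ _ h₃ hp
      exact ⟨_, h₁, h₄, ⟨_, h₆, h₇, ⟨_, h₈, hv⟩, ⟨_, h₉, hkq⟩⟩, ⟨_, h₅, hvp⟩⟩
    · obtain ⟨hla, ⟨p, hp, hvp⟩, ⟨q, hq, hkq⟩⟩ := hk
      obtain ⟨w, rfl, rfl, rfl, h₁, hw⟩ := key hCons₂ hla
      simp only [holds_conj, List.forall_mem_cons, List.not_mem_nil,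
        false_imp_iff, implies_true, and_true, holds_lab, holds_ptr] at hw
      obtain ⟨⟨h₂, h₃, h₄, h₅, h₆, h₇, h₈, h₉⟩, h₁₀⟩ := hw
      obtain rfl := hfun _ _ _ _ h₂ hq
      obtain rfl := hfun _ _ _ _ h₃ hp
      exact ⟨_, h₁, h₄, ⟨_, h₅, hkq⟩,
        ⟨_, h₆, h₇, ⟨_, h₈, hI.repNat_headI hvp h₉⟩, ⟨_, h₁₀, hv⟩⟩⟩
    · obtain ⟨hla, ⟨q, hq, hkq⟩⟩ := hk
      obtain ⟨w, rfl, rfl, rfl, h₁, hw⟩ := key (hr _ (hc.1 (mem_codes _))).2.2.1 hla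
      simp only [holds_conj, List.forall_mem_cons, List.not_mem_nil,
        false_imp_iff, implies_true, and_true, holds_lab, holds_ptr] at hw
      obtain ⟨⟨h₂, h₃, h₄⟩, h₅⟩ := hw
      obtain rfl := hfun _ _ _ _ h₂ hq
      exact ⟨_, h₁, h₃, ⟨_, h₄, hkq⟩, ⟨_, h₅, hv⟩⟩
    · obtain ⟨w, rfl, rfl, rfl, h₁, hw⟩ := key (hr _ (hc.1 (mem_codes _))).2.2.2 hk.1
      -- `id` preserves `hk`: if the loop continues, the `fix` continuation itself is kept.
      obtain ⟨hla, ⟨q, hq, hkq⟩⟩ := id hk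
      simp only [holds_conj, List.forall_mem_cons, List.not_mem_nil,
        false_imp_iff, implies_true, and_true, holds_lab, holds_ptr, holds_or] at hw
      obtain ⟨⟨h₂, h₃, h₄, h₅⟩, hw⟩ := hw
      obtain rfl := hfun _ _ _ _ h₂ hq
      have hn := hI.repNat_headI hv h₃
      refine ⟨_, h₁, ?_⟩
      split_ifs with hz
      · rw [hz] at hn
        rcases hw with ⟨⟨h₆, h₇⟩, h₈⟩ | ⟨⟨h₆, h₇⟩, h₈⟩
        · exact ⟨h₇, ⟨_, h₈, hkq⟩, ⟨_, h₄, hI.repList_tail hv h₅⟩⟩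
        · exact absurd ⟨hn, h₆⟩ (hI.zero_succ _)
      · obtain ⟨y, hy⟩ := Nat.exists_eq_succ_of_ne_zero hz
        rw [hy] at hn
        rcases hw with ⟨⟨h₆, h₇⟩, h₈⟩ | ⟨⟨h₆, h₇⟩, h₈⟩
        · exact absurd ⟨h₆, hn.1⟩ (hI.zero_succ _)
        · exact ⟨h₇, ⟨_, h₈, hk⟩, ⟨_, h₄, hI.repList_tail hv h₅⟩⟩
  | .halt v => cases h

theorem repNat_of_holds_numeral {n : ℕ} {v : ℕ → M} (h : I.Holds v (numeral n)) :
    I.RepNat n (v 0) := by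
  induction n generalizing v with
  | zero => exact h
  | succ n ih =>
    simp only [numeral, holds_and, holds_lab, Holds.eq_6, holds_ptr, holds_eq] at h
    obtain ⟨h₁, b, h₂, a, h₃, h₄⟩ := h
    simp only [Function.update_self, ne_eq, one_ne_zero, zero_ne_one, not_false_eq_true,
      Function.update_of_ne] at h₂ h₃
    refine ⟨h₁, b, h₂, ?_⟩
    simpa [h₃] using ih h₄

theorem exists_first {c : Code} {n : ℕ} {v : ℕ → M} (h : I.Holds v (start c n)) :
    ∃ t, I.Lab .first t ∧ I.Lab (.kind .config) t ∧ I.RepConfig (.norm c .halt [n]) t := by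
  obtain ⟨a, h⟩ := h
  rw [holds_and] at h
  obtain ⟨h₁, h₂⟩ := h
  have hn := repNat_of_holds_numeral h₁
  simp only [input, holds_exBut, holds_conj, List.forall_mem_cons, List.not_mem_nil,
    false_imp_iff, implies_true, and_true, holds_lab, holds_ptr] at h₂
  obtain ⟨w, hw, ⟨h₁, h₂, h₃, h₄, h₅, h₆, h₇, h₈, h₉⟩, h₁₀⟩ := h₂
  rw [← hw] at hn
  exact ⟨w 1, h₁, h₂, h₃, ⟨_, h₄, h₅⟩, ⟨_, h₆, h₇, ⟨_, h₈, hn⟩, ⟨_, h₉, h₁₀⟩⟩⟩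

theorem IsRun.exists_rep (hI : I.IsRun L) {c : Config} (hc : c.In L) {t : M}
    (hk : I.Lab (.kind .config) t) (ht : I.RepConfig c t) :
    ∃ u : ℕ → M, u 0 = t ∧ (∀ i, I.Lab (.kind .config) (u i) ∧ (c.run i).In L ∧
      I.RepConfig (c.run i) (u i)) ∧
      ∀ i, (c.run i).step ≠ none → I.Ptr .config (u i) (u (i + 1)) := by
  -- Stated as an implication for all pairs, so that choice yields a total function that can be
  -- iterated.
  have key (p : ℕ × M) : ∃ t', I.Lab (.kind .config) p.2 ∧ (c.run p.1).In L ∧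
      I.RepConfig (c.run p.1) p.2 → (I.Lab (.kind .config) t' ∧ (c.run (p.1 + 1)).In L ∧
      I.RepConfig (c.run (p.1 + 1)) t') ∧
      ((c.run p.1).step ≠ none → I.Ptr .config p.2 t') := by
    rcases hs : (c.run p.1).step with _ | d
    -- After halting the sequence stays put, as `run` does.
    · exact ⟨p.2, fun h => ⟨by simpa [Config.run, hs] using h, by simp⟩⟩
    · rw [Config.run_succ hs]
      by_cases h : I.Lab (.kind .config) p.2 ∧ (c.run p.1).In L ∧ I.RepConfig (c.run p.1) p.2
      · obtain ⟨t', h₁, h₂⟩ := hI.exists_step h.2.1 h.2.2 hs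
        exact ⟨t', fun _ => ⟨⟨h₁.2, h.2.1.step hs, h₂⟩, fun _ => h₁⟩⟩
      · exact ⟨p.2, fun h' => absurd h' h⟩
  choose f hf using key
  let u : ℕ → M := fun i => Nat.rec t (fun i a => f (i, a)) i
  have hu (i : ℕ) : I.Lab (.kind .config) (u i) ∧ (c.run i).In L ∧
      I.RepConfig (c.run i) (u i) := by
    induction i with
    | zero => exact ⟨hk, hc, ht⟩
    | succ i ih => exact (hf (i, u i) ih).1
  exact ⟨u, rfl, hu, fun i => (hf (i, u i) (hu i)).2⟩

theorem exists_rep_of_models [Nonempty M] {c : Code} {n : ℕ} (h : I.Models (runs c n)) :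
    I.IsRun (codes c) ∧ ∃ u : ℕ → M, I.Lab .first (u 0) ∧
      (∀ i, I.Lab (.kind .config) (u i) ∧
        I.RepConfig ((Config.norm c .halt [n]).run i) (u i)) ∧
      ∀ i, ((Config.norm c .halt [n]).run i).step ≠ none →
        I.Ptr .config (u i) (u (i + 1)) := by
  have h' (v : ℕ → M) := (I.holds_and _ _ _).1 (h v)
  have hI : I.IsRun (codes c) := isRun_iff.2 fun v => ((I.holds_conj _ _ _).1 (h' v).2).1
  obtain ⟨t, h₁, h₂, h₃⟩ := exists_first (h' fun _ => Classical.arbitrary M).1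
  obtain ⟨u, rfl, h₄, h₅⟩ := hI.exists_rep (c := .norm c .halt [n])
    ⟨List.Subset.refl _, trivial⟩ h₂ h₃
  exact ⟨hI, u, h₁, fun i => ⟨(h₄ i).1, (h₄ i).2.2⟩, h₅⟩

/-- Were the run infinite, the successor pointers would never stop. Following equal elements
backwards by injectivity ends at the initial configuration, which has no predecessor, so the
sequence of representatives would be injective in a finite set. -/
theorem eval_dom_of_models_runs [Nonempty M] [Finite M] {c : Code} {n : ℕ}
    (h : I.Models (runs c n)) : (c.eval [n]).Dom := by
  obtain ⟨hI, u, h₁, h₂, h₃⟩ := exists_rep_of_models h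
  rw [← Config.eval_step_dom, Config.eval_dom_iff]
  by_contra! hne
  refine not_injective_infinite_finite u fun i j => ?_
  induction i generalizing j with
  | zero =>
    rcases j with _ | j
    · exact fun _ => rfl
    · exact fun hij => absurd (hij ▸ h₃ j (hne j)) (hI.initial _ _ (h₂ j).1 h₁)
  | succ i ih =>
    rcases j with _ | j
    · exact fun hij => absurd (hij ▸ h₃ i (hne i)) (hI.initial _ _ (h₂ i).1 h₁)
    · intro hij
      rw [ih j (hI.injective _ _ _ (h₂ i).1 (h₂ j).1 (h₃ i (hne i)) (hij ▸ h₃ j (hne j)))]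

/-- No finiteness or injectivity is needed: a halting run would put the forbidden label on one of
its representatives. -/
theorem not_eval_dom_of_models_diverges [Nonempty M] {c : Code} {n : ℕ}
    (h : I.Models (diverges c n)) : ¬ (c.eval [n]).Dom := by
  have h' (v : ℕ → M) := (I.holds_and _ _ _).1 (h v)
  obtain ⟨hI, u, h₁, h₂, h₃⟩ := exists_rep_of_models fun v => (h' v).1
  rw [← Config.eval_step_dom, Config.eval_dom_iff]
  rintro ⟨i, hi⟩
  obtain ⟨v, hv⟩ := Config.step_eq_none.1 hi
  have hu := (h₂ i).2
  rw [hv] at hu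
  exact (I.holds_all _ _).1 (h' u).2 (fun _ => u i) hu

end Interp

/-! ### Completeness: the data needed to encode a run. -/

/-- The elements of structures that encode runs: points of time, continuations, lists and
numbers. -/
inductive Elem : Type
  | time : ℕ → Elem
  | cont : Cont → Elem
  | list : List ℕ → Elem
  | nat : ℕ → Elem

namespace Elem

/-- The sort of an element. -/
def kind : Elem → Kind
  | time _ => .config
  | cont _ => .cont
  | list _ => .list
  | nat _ => .nat

/-- The components of data. -/
def part : Elem → Kind → Option Elem
  | cont (.cons₁ _ _ k), .cont => some (cont k)
  | cont (.cons₁ _ v _), .list => some (list v)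
  | cont (.cons₂ _ k), .cont => some (cont k)
  | cont (.cons₂ v _), .list => some (list v)
  | cont (.comp _ k), .cont => some (cont k)
  | cont (.fix _ k), .cont => some (cont k)
  | list (_ :: l), .list => some (list l)
  | list (n :: _), .nat => some (nat n)
  | nat (n + 1), .nat => some (nat n)
  | _, _ => none

/-- The components of a configuration. -/
def configPart : Config → Kind → Option Elem
  | .norm _ k _, .cont => some (cont k)
  | .norm _ _ v, .list => some (list v)
  | .ret k _, .cont => some (cont k)
  | .ret _ v, .list => some (list v)
  | _, _ => none

/-- The components of elements, where `r i` is the configuration at time `i`. -/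
def component (r : ℕ → Config) : Elem → Kind → Option Elem
  | time i, .config => some (time (i + 1))
  | time i, s => configPart (r i) s
  | x, s => x.part s

/-- The label of a configuration. -/
def configLabel : Config → Label
  | .norm c _ _ => .norm c
  | .ret _ _ => .ret
  | .halt _ => .halt

/-- The outermost constructor of an element. -/
def label (r : ℕ → Config) : Elem → Label
  | time i => configLabel (r i)
  | cont .halt => .contHalt
  | cont (.cons₁ c _ _) => .contCons₁ c
  | cont (.cons₂ _ _) => .contCons₂
  | cont (.comp c _) => .contComp c
  | cont (.fix c _) => .contFix c
  | list [] => .nil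
  | list (_ :: _) => .cons
  | nat 0 => .zero
  | nat (_ + 1) => .succ

/-- The labels of an element. -/
def HasLabel (r : ℕ → Config) (l : Label) (x : Elem) : Prop :=
  l = .kind x.kind ∨ (l = .first ∧ x = time 0) ∨ l = x.label r

/-- A set of data that contains the components of its elements. -/
def Closed (s : Set Elem) : Prop :=
  ∀ x ∈ s, x.kind ≠ .config ∧ ∀ k y, x.part k = some y → y ∈ s

theorem Closed.union {s t : Set Elem} (hs : Closed s) (ht : Closed t) : Closed (s ∪ t) := by
  rintro x (hx | hx)
  · exact ⟨(hs x hx).1, fun k y h => .inl ((hs x hx).2 k y h)⟩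
  · exact ⟨(ht x hx).1, fun k y h => .inr ((ht x hx).2 k y h)⟩

theorem Closed.insert {s : Set Elem} (hs : Closed s) {x : Elem} (hx : x.kind ≠ .config)
    (h : ∀ k y, x.part k = some y → y ∈ s) : Closed (insert x s) := by
  rintro y (rfl | hy)
  · exact ⟨hx, fun k y h' => .inr (h k y h')⟩
  · exact ⟨(hs y hy).1, fun k z h' => .inr ((hs y hy).2 k z h')⟩

theorem exists_closed_nat (n : ℕ) : ∃ s : Set Elem, s.Finite ∧ Closed s ∧ nat n ∈ s := by
  induction n with
  | zero =>
    refine ⟨{nat 0}, Set.finite_singleton _, ?_, rfl⟩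
    rintro _ rfl
    simp [kind, part]
  | succ n ih =>
    obtain ⟨s, h₁, h₂, h₃⟩ := ih
    refine ⟨insert (nat (n + 1)) s, h₁.insert _, h₂.insert (by simp [kind]) ?_, .inl rfl⟩
    rintro (_ | _ | _ | _) y h <;> simp [part] at h
    exact h ▸ h₃

theorem exists_closed_list (l : List ℕ) : ∃ s : Set Elem, s.Finite ∧ Closed s ∧ list l ∈ s := by
  induction l with
  | nil =>
    refine ⟨{list []}, Set.finite_singleton _, ?_, rfl⟩
    rintro _ rfl
    simp [kind, part]
  | cons n l ih =>
    obtain ⟨s, h₁, h₂, h₃⟩ := ih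
    obtain ⟨t, h₄, h₅, h₆⟩ := exists_closed_nat n
    refine ⟨insert (list (n :: l)) (s ∪ t), (h₁.union h₄).insert _,
      (h₂.union h₅).insert (by simp [kind]) ?_, .inl rfl⟩
    rintro (_ | _ | _ | _) y h <;> simp [part] at h
    · exact h ▸ .inl h₃
    · exact h ▸ .inr h₆

/-- A continuation has only finitely many hereditary components; this keeps the structure of a
halting run finite. -/
theorem exists_closed_cont (k : Cont) : ∃ s : Set Elem, s.Finite ∧ Closed s ∧ cont k ∈ s := by
  induction k with
  | halt =>
    refine ⟨{cont .halt}, Set.finite_singleton _, ?_, rfl⟩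
    rintro _ rfl
    simp [kind, part]
  | cons₁ c v k ih | cons₂ v k ih =>
    obtain ⟨s, h₁, h₂, h₃⟩ := ih
    obtain ⟨t, h₄, h₅, h₆⟩ := exists_closed_list v
    refine ⟨insert _ (s ∪ t), (h₁.union h₄).insert _,
      (h₂.union h₅).insert (by simp [kind]) ?_, .inl rfl⟩
    rintro (_ | _ | _ | _) y h <;> simp [part] at h
    · exact h ▸ .inl h₃
    · exact h ▸ .inr h₆
  | comp c k ih | fix c k ih =>
    obtain ⟨s, h₁, h₂, h₃⟩ := ih
    refine ⟨insert _ s, h₁.insert _, h₂.insert (by simp [kind]) ?_, .inl rfl⟩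
    rintro (_ | _ | _ | _) y h <;> simp [part] at h
    exact h ▸ h₃

theorem exists_closed_config (c : Config) : ∃ s : Set Elem, s.Finite ∧ Closed s ∧
    ∀ k y, configPart c k = some y → y ∈ s := by
  match c with
  | .norm _ k v | .ret k v =>
    obtain ⟨s, h₁, h₂, h₃⟩ := exists_closed_cont k
    obtain ⟨t, h₄, h₅, h₆⟩ := exists_closed_list v
    refine ⟨s ∪ t, h₁.union h₄, h₂.union h₅, ?_⟩
    rintro (_ | _ | _ | _) y h <;> simp [configPart] at h
    · exact h ▸ .inl h₃
    · exact h ▸ .inr h₆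
  | .halt _ => exact ⟨∅, Set.finite_empty, fun _ h => h.elim, by simp [configPart]⟩

/-- A set of elements that supports the structure encoding the run `r`. -/
structure Supports (r : ℕ → Config) (S : Set Elem) : Prop where
  zero : nat 0 ∈ S
  nil : list [] ∈ S
  part {x y : Elem} {k : Kind} : x ∈ S → x.part k = some y → y ∈ S
  configPart {i : ℕ} {y : Elem} {k : Kind} : time i ∈ S → configPart (r i) k = some y → y ∈ S
  time {i : ℕ} {d : Config} : time i ∈ S → (r i).step = some d → time (i + 1) ∈ S

theorem Supports.headI {r : ℕ → Config} {S : Set Elem} (hS : Supports r S) {v : List ℕ}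
    (hv : list v ∈ S) : nat v.headI ∈ S := by
  cases v with
  | nil => exact hS.zero
  | cons n l => exact hS.part (k := .nat) hv rfl

theorem Supports.tail {r : ℕ → Config} {S : Set Elem} (hS : Supports r S) {v : List ℕ}
    (hv : list v ∈ S) : list v.tail ∈ S := by
  cases v with
  | nil => exact hS.nil
  | cons n l => exact hS.part (k := .list) hv rfl

/-- Take the times in `T`, a finite closed set of data for each of their configurations, and the two
default values `0` and `[]` of `headI` and `tail`. The closed sets contain no times, so the times
present are exactly those of `T`. -/
theorem exists_supports (r : ℕ → Config) (T : Set ℕ)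
    (hT : ∀ i ∈ T, (r i).step ≠ none → i + 1 ∈ T) :
    ∃ S : Set Elem, Supports r S ∧ (∀ i, time i ∈ S ↔ i ∈ T) ∧ S.Countable ∧
      (T.Finite → S.Finite) := by
  choose s hfin hcl hs using fun i => exists_closed_config (r i)
  have hbase : Closed {nat 0, list []} := by
    rintro _ (rfl | rfl) <;> simp [kind, part]
  have htime (i j : ℕ) : time i ∉ s j := fun h => (hcl j _ h).1 rfl
  refine ⟨{nat 0, list []} ∪ Set.image time T ∪ ⋃ i ∈ T, s i, ?_, ?_, ?_, ?_⟩
  · constructor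
    · simp
    · simp
    · rintro x y k ((hx | ⟨i, -, rfl⟩) | hx) h
      · exact .inl (.inl ((hbase x hx).2 k y h))
      · simp [part] at h
      · simp only [Set.mem_iUnion] at hx
        obtain ⟨i, hi, hx⟩ := hx
        exact .inr (Set.mem_biUnion hi ((hcl i x hx).2 k y h))
    · intro i y k hi h
      have hi : i ∈ T := by simpa [htime] using hi
      exact .inr (Set.mem_biUnion hi (hs i k y h))
    · intro i d hi h
      have hi : i ∈ T := by simpa [htime] using hi
      exact .inl (.inr ⟨i + 1, hT i hi (by simp [h]), rfl⟩)
  · simp [htime]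
  · exact ((Set.to_countable _).union ((Set.to_countable _).image _)).union
      (Set.Countable.biUnion (Set.to_countable _) fun i _ => (hfin i).countable)
  · exact fun h => ((Set.toFinite _).union (h.image _)).union (h.biUnion fun i _ => hfin i)

end Elem

open Elem

/-- The structure that encodes the run `r`, with domain `S` ordered by `lt`. -/
def runInterp (r : ℕ → Config) (S : Set Elem) (lt : S → S → Prop) : Interp S where
  unary p x := ∃ l : Label, l.symbol = p ∧ HasLabel r l x
  bin
    | .rel, x, y => component r x y.1.kind = some y.1
    | .less, x, y => lt x y
    | .succ, x, y => lt x y ∧ ¬ ∃ z, lt x z ∧ lt z y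

/-! ### The encoding structure satisfies the axioms. -/

section

variable {r : ℕ → Config} {S : Set Elem} {lt : S → S → Prop}

theorem lab_runInterp (l : Label) (x : S) :
    (runInterp r S lt).Lab l x ↔ HasLabel r l x := by
  constructor
  · rintro ⟨l', hl, h⟩
    rwa [← Label.symbol_injective hl]
  · exact fun h => ⟨l, rfl, h⟩

/-- The sort label of `y` can only come from its kind, so `rel` compares `y` with exactly one
component of `x`. -/
theorem ptr_runInterp (s : Kind) (x y : S) :
    (runInterp r S lt).Ptr s x y ↔ y.1.kind = s ∧ component r x s = some y.1 := by
  have : HasLabel r (.kind s) y ↔ y.1.kind = s := by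
    rcases y with ⟨_ | (_ | _) | (_ | _) | (_ | _), _⟩ <;>
      simp [HasLabel, label, eq_comm]
    rename_i i _
    cases r i <;> simp [configLabel]
  rw [Interp.Ptr, lab_runInterp, this, and_comm]
  refine and_congr_right fun h => ?_
  change component r x y.1.kind = some y.1 ↔ _
  rw [h]

theorem exists_of_lab_norm {c : Code} {t : S} (h : (runInterp r S lt).Lab (.norm c) t) :
    ∃ i k v, t.1 = time i ∧ r i = .norm c k v := by
  rw [lab_runInterp] at h
  rcases t with ⟨_ | (_ | _) | (_ | _) | (_ | _), _⟩ <;> simp [HasLabel, label] at h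
  rename_i i _
  refine ⟨i, ?_⟩
  cases hr : r i <;> simp_all [configLabel]

theorem exists_of_lab_ret {t : S} (h : (runInterp r S lt).Lab .ret t) :
    ∃ i k v, t.1 = time i ∧ r i = .ret k v := by
  rw [lab_runInterp] at h
  rcases t with ⟨_ | (_ | _) | (_ | _) | (_ | _), _⟩ <;> simp [HasLabel, label] at h
  rename_i i _
  refine ⟨i, ?_⟩
  cases hr : r i <;> simp_all [configLabel]

theorem exists_of_ptr_cont {i : ℕ} {k : Cont} {v : List ℕ} (hi : r i = .ret k v) {t x : S}
    (ht : t.1 = time i) (h : (runInterp r S lt).Ptr .cont t x) : x.1 = cont k := by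
  rw [ptr_runInterp, ht] at h
  simpa [component, hi, configPart, eq_comm] using h.2

theorem holds_head_runInterp {w : ℕ → S} {x y : ℕ} {l : List ℕ} (hx : (w x).1 = list l)
    (hy : (w y).1 = nat l.headI) : (runInterp r S lt).Holds w (head x y) := by
  cases l <;> simp [head, lab_runInterp, ptr_runInterp, hx, hy, HasLabel, label, component, part,
    kind]

theorem holds_tail_runInterp {w : ℕ → S} {x y : ℕ} {l : List ℕ} (hx : (w x).1 = list l)
    (hy : (w y).1 = list l.tail) : (runInterp r S lt).Holds w (tail x y) := by
  cases l <;> simp [tail, lab_runInterp, ptr_runInterp, hx, hy, HasLabel, label, component, part,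
    kind]

/-- An assignment of the variables `0, …, 7`. -/
def assign {α : Type} (a₀ a₁ a₂ a₃ a₄ a₅ a₆ a₇ : α) : ℕ → α
  | 0 => a₀
  | 1 => a₁
  | 2 => a₂
  | 3 => a₃
  | 4 => a₄
  | 5 => a₅
  | 6 => a₆
  | _ => a₇

theorem Elem.Supports.next (hr : ∀ i d, (r i).step = some d → r (i + 1) = d)
    (hS : Supports r S) {i : ℕ} {c d : Config} (ht : Elem.time i ∈ S) (hi : r i = c)
    (hd : c.step = some d) : r (i + 1) = d ∧ Elem.time (i + 1) ∈ S ∧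
      ∀ s y, Elem.configPart d s = some y → y ∈ S := by
  subst hi
  refine ⟨hr i d hd, hS.time ht hd, fun s y h => ?_⟩
  rw [← hr i d hd] at h
  exact hS.configPart (hS.time ht hd) h

attribute [local simp] Interp.holds_conj lab_runInterp ptr_runInterp assign HasLabel label
  component configPart configLabel part kind

/-- The witnesses are the actual data of the current and the next configuration, present in `S` by
`Supports`. Variables that the rule does not mention get the element for the current time as a
dummy. -/
theorem holds_normRule_runInterp (hr : ∀ i d, (r i).step = some d → r (i + 1) = d)
    (hS : Supports r S) (v : ℕ → S) (c : Code) :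
    (runInterp r S lt).Holds v (normRule c) := by
  rw [Interp.holds_normRule]
  rintro ⟨t, ht⟩ h
  obtain ⟨i, k, v, rfl, hi⟩ := exists_of_lab_norm h
  have hk : cont k ∈ S := hS.configPart (k := .cont) ht (by rw [hi]; rfl)
  have hv : list v ∈ S := hS.configPart (k := .list) ht (by rw [hi]; rfl)
  have hh := hS.headI hv
  have htl := hS.tail hv
  cases c with
  | zero' =>
    obtain ⟨hd, ht', hp⟩ := hS.next hr ht hi rfl
    refine ⟨assign ⟨_, ht⟩ ⟨_, ht'⟩ ⟨_, hk⟩ ⟨_, hv⟩ ⟨list (0 :: v), hp .list _ rfl⟩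
      ⟨nat 0, hS.zero⟩ ⟨_, ht⟩ ⟨_, ht⟩, rfl, ?_⟩
    simp [normBody, frame, hd, hi]
  | succ =>
    obtain ⟨hd, ht', hp⟩ := hS.next hr ht hi rfl
    have h₁ : list [v.headI + 1] ∈ S := hp .list _ rfl
    refine ⟨assign ⟨_, ht⟩ ⟨_, ht'⟩ ⟨_, hk⟩ ⟨_, hv⟩ ⟨_, h₁⟩ ⟨nat (v.headI + 1), hS.headI h₁⟩
      ⟨_, hh⟩ ⟨_, hS.nil⟩, rfl, ?_⟩
    simp [normBody, frame, hd, hi]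
    exact holds_head_runInterp rfl rfl
  | tail =>
    obtain ⟨hd, ht', hp⟩ := hS.next hr ht hi rfl
    refine ⟨assign ⟨_, ht⟩ ⟨_, ht'⟩ ⟨_, hk⟩ ⟨_, hv⟩ ⟨_, htl⟩ ⟨_, ht⟩ ⟨_, ht⟩ ⟨_, ht⟩, rfl, ?_⟩
    simp [normBody, frame, hd, hi]
    exact holds_tail_runInterp rfl rfl
  | cons f fs =>
    obtain ⟨hd, ht', hp⟩ := hS.next hr ht hi rfl
    refine ⟨assign ⟨_, ht⟩ ⟨_, ht'⟩ ⟨_, hk⟩ ⟨_, hv⟩ ⟨_, hp .cont _ rfl⟩ ⟨_, ht⟩ ⟨_, ht⟩ ⟨_, ht⟩,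
      rfl, ?_⟩
    simp [normBody, frame, hd, hi]
  | comp f g =>
    obtain ⟨hd, ht', hp⟩ := hS.next hr ht hi rfl
    refine ⟨assign ⟨_, ht⟩ ⟨_, ht'⟩ ⟨_, hk⟩ ⟨_, hv⟩ ⟨_, hp .cont _ rfl⟩ ⟨_, ht⟩ ⟨_, ht⟩ ⟨_, ht⟩,
      rfl, ?_⟩
    simp [normBody, frame, hd, hi]
  | case f g =>
    rcases hy : v.headI with _ | y
    · obtain ⟨hd, ht', hp⟩ := hS.next (d := .norm f k v.tail) hr ht hi (by simp [Config.step, hy])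
      refine ⟨assign ⟨_, ht⟩ ⟨_, ht'⟩ ⟨_, hk⟩ ⟨_, hv⟩ ⟨_, htl⟩ ⟨_, hS.zero⟩ ⟨_, ht⟩ ⟨_, ht⟩,
        rfl, ?_⟩
      simp [normBody, frame, hd, hi]
      exact ⟨holds_head_runInterp (l := v) rfl (by rw [hy]; rfl),
        holds_tail_runInterp (l := v) rfl rfl⟩
    · obtain ⟨hd, ht', hp⟩ := hS.next (d := .norm g k (y :: v.tail)) hr ht hi
        (by simp [Config.step, hy])
      have h₁ : list (y :: v.tail) ∈ S := hp .list _ rfl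
      rw [hy] at hh
      refine ⟨assign ⟨_, ht⟩ ⟨_, ht'⟩ ⟨_, hk⟩ ⟨_, hv⟩ ⟨_, h₁⟩ ⟨_, hh⟩ ⟨_, htl⟩
        ⟨nat y, hS.headI h₁⟩, rfl, ?_⟩
      simp [normBody, frame, hd, hi]
      exact ⟨holds_head_runInterp (l := v) rfl (by rw [hy]; rfl),
        holds_tail_runInterp (l := v) rfl rfl⟩
  | fix f =>
    obtain ⟨hd, ht', hp⟩ := hS.next hr ht hi rfl
    refine ⟨assign ⟨_, ht⟩ ⟨_, ht'⟩ ⟨_, hk⟩ ⟨_, hv⟩ ⟨_, hp .cont _ rfl⟩ ⟨_, ht⟩ ⟨_, ht⟩ ⟨_, ht⟩,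
      rfl, ?_⟩
    simp [normBody, frame, hd, hi]

/-- Common part of the return rules: the variables `0` to `3` are dictated by the frame, so each
rule only has to find the next time and the variables from `4` on. -/
theorem holds_retRule_runInterp (hS : Supports r S) (v : ℕ → S) (l : Label) (ψ : Formula)
    (h : ∀ i k v (ht : time i ∈ S) (hk : cont k ∈ S) (hv : list v ∈ S), r i = .ret k v →
      HasLabel r l (cont k) → ∃ (ht' : time (i + 1) ∈ S) (a₄ a₅ a₆ a₇ : S),
        (runInterp r S lt).Holds (assign ⟨_, ht⟩ ⟨_, ht'⟩ ⟨_, hk⟩ ⟨_, hv⟩ a₄ a₅ a₆ a₇) ψ) :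
    (runInterp r S lt).Holds v (retRule l ψ) := by
  rw [Interp.holds_retRule]
  rintro ⟨t, ht⟩ ⟨x, hx⟩ h₁ h₂ h₃
  obtain ⟨i, k, v, rfl, hi⟩ := exists_of_lab_ret h₁
  obtain rfl : x = cont k := exists_of_ptr_cont hi rfl h₂
  have hv : list v ∈ S := hS.configPart (k := .list) ht (by rw [hi]; rfl)
  obtain ⟨ht', a₄, a₅, a₆, a₇, hψ⟩ := h i k v ht hx hv hi ((lab_runInterp _ _).1 h₃)
  exact ⟨_, rfl, by simp [frame, hi], hψ⟩

theorem holds_haltRule_runInterp (hr : ∀ i d, (r i).step = some d → r (i + 1) = d)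
    (hS : Supports r S) (v : ℕ → S) : (runInterp r S lt).Holds v haltRule := by
  refine holds_retRule_runInterp hS v _ _ fun i k v ht hk hv hi hl => ?_
  cases k <;> simp at hl
  obtain ⟨hd, ht', hp⟩ := hS.next hr ht hi rfl
  exact ⟨ht', ⟨_, ht⟩, ⟨_, ht⟩, ⟨_, ht⟩, ⟨_, ht⟩, by simp [hd]⟩

theorem holds_cons₁Rule_runInterp (hr : ∀ i d, (r i).step = some d → r (i + 1) = d)
    (hS : Supports r S) (v : ℕ → S) (f : Code) :
    (runInterp r S lt).Holds v (cons₁Rule f) := by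
  refine holds_retRule_runInterp hS v _ _ fun i k v ht hk hv hi hl => ?_
  cases k <;> simp at hl
  subst hl
  obtain ⟨hd, ht', hp⟩ := hS.next hr ht hi rfl
  exact ⟨ht', ⟨_, hS.part (k := .cont) hk rfl⟩, ⟨_, hS.part (k := .list) hk rfl⟩,
    ⟨_, hp .cont _ rfl⟩, ⟨_, ht⟩, by simp [hd]⟩

theorem holds_cons₂Rule_runInterp (hr : ∀ i d, (r i).step = some d → r (i + 1) = d)
    (hS : Supports r S) (v : ℕ → S) : (runInterp r S lt).Holds v cons₂Rule := by
  refine holds_retRule_runInterp hS v _ _ fun i k v ht hk hv hi hl => ?_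
  cases k <;> simp at hl
  obtain ⟨hd, ht', hp⟩ := hS.next hr ht hi rfl
  have h₁ := hS.part (k := .list) hk rfl
  refine ⟨ht', ⟨_, hS.part (k := .cont) hk rfl⟩, ⟨_, h₁⟩, ⟨_, hp .list _ rfl⟩,
    ⟨_, hS.headI h₁⟩, ?_⟩
  simp [hd]
  exact holds_head_runInterp rfl rfl

theorem holds_compRule_runInterp (hr : ∀ i d, (r i).step = some d → r (i + 1) = d)
    (hS : Supports r S) (v : ℕ → S) (f : Code) :
    (runInterp r S lt).Holds v (compRule f) := by
  refine holds_retRule_runInterp hS v _ _ fun i k v ht hk hv hi hl => ?_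
  cases k <;> simp at hl
  subst hl
  obtain ⟨hd, ht', hp⟩ := hS.next hr ht hi rfl
  exact ⟨ht', ⟨_, hS.part (k := .cont) hk rfl⟩, ⟨_, ht⟩, ⟨_, ht⟩, ⟨_, ht⟩, by simp [hd]⟩

theorem holds_fixRule_runInterp (hr : ∀ i d, (r i).step = some d → r (i + 1) = d)
    (hS : Supports r S) (v : ℕ → S) (f : Code) :
    (runInterp r S lt).Holds v (fixRule f) := by
  refine holds_retRule_runInterp hS v _ _ fun i k v ht hk hv hi hl => ?_
  cases k <;> simp at hl
  subst hl
  obtain ⟨hd, ht', hp⟩ := hS.next hr ht hi rfl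
  have hh := hS.headI hv
  rcases hy : v.headI with _ | y <;> rw [hy] at hh <;>
    refine ⟨ht', ⟨_, hS.part (k := .cont) hk rfl⟩, ⟨_, hh⟩, ⟨_, hS.tail hv⟩, ⟨_, ht⟩, ?_⟩
  · simp [hy] at hd
    simp [hd]
    exact ⟨holds_head_runInterp (l := v) rfl (by rw [hy]; rfl),
      holds_tail_runInterp (l := v) rfl rfl⟩
  · simp [hy] at hd
    simp [hd]
    exact ⟨holds_head_runInterp (l := v) rfl (by rw [hy]; rfl),
      holds_tail_runInterp (l := v) rfl rfl⟩

/-- Functionality holds because `component` is a function. Among elements only times have sort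
`config`, and their successor is `i ↦ i + 1`, which is injective and omits `0`. -/
theorem isRun_runInterp (hr : ∀ i d, (r i).step = some d → r (i + 1) = d)
    (hS : Supports r S) (L : List Code) : (runInterp r S lt).IsRun L where
  functional s a b c hb hc := by
    rw [ptr_runInterp] at hb hc
    exact Subtype.ext (Option.some.inj (hb.2.symm.trans hc.2))
  nil_cons a := by
    rcases a with ⟨_ | (_ | _) | (_ | _) | (_ | _), _⟩ <;> simp
    rename_i i _
    cases r i <;> simp
  zero_succ a := by
    rcases a with ⟨_ | (_ | _) | (_ | _) | (_ | _), _⟩ <;> simp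
    rename_i i _
    cases r i <;> simp
  injective a b c ha hb hac hbc := by
    rw [ptr_runInterp] at hac hbc
    rcases a with ⟨_ | (_ | _) | (_ | _) | (_ | _), _⟩ <;> simp at ha hac
    rcases b with ⟨_ | (_ | _) | (_ | _) | (_ | _), _⟩ <;> simp at hb hbc
    simpa [← hac.2] using hbc.2.symm
  initial a b ha hb hab := by
    rw [ptr_runInterp] at hab
    rcases a with ⟨_ | (_ | _) | (_ | _) | (_ | _), _⟩ <;> simp at ha hab
    rw [lab_runInterp, ← hab.2] at hb
    rename_i i _
    cases h : r (i + 1) <;> simp [h] at hb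
  rules v := ⟨holds_haltRule_runInterp hr hS v, holds_cons₂Rule_runInterp hr hS v, fun c _ =>
    ⟨holds_normRule_runInterp hr hS v c, holds_cons₁Rule_runInterp hr hS v c,
      holds_compRule_runInterp hr hS v c, holds_fixRule_runInterp hr hS v c⟩⟩

theorem holds_numeral_runInterp (hS : Supports r S) {n : ℕ} {v : ℕ → S}
    (h : (v 0).1 = nat n) : (runInterp r S lt).Holds v (numeral n) := by
  induction n generalizing v with
  | zero => simp [numeral, h]
  | succ n ih =>
    have hn : nat n ∈ S := hS.part (k := .nat) (v 0).2 (by rw [h]; rfl)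
    rw [numeral, Interp.holds_and]
    refine ⟨by simp [h], ⟨nat n, hn⟩, ?_⟩
    rw [Interp.holds_and]
    refine ⟨by simp [h], ⟨nat n, hn⟩, ?_⟩
    rw [Interp.holds_and]
    exact ⟨by simp, ih (by simp)⟩

theorem models_runs_runInterp (hr : ∀ i d, (r i).step = some d → r (i + 1) = d)
    (hS : Supports r S) (h₀ : time 0 ∈ S) {c : Code} {n : ℕ} (hc : r 0 = .norm c .halt [n]) :
    (runInterp r S lt).Models (runs c n) := by
  intro v
  have : Nonempty S := ⟨⟨_, h₀⟩⟩
  have hk : cont .halt ∈ S := hS.configPart (k := .cont) h₀ (by rw [hc]; rfl)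
  have hl : list [n] ∈ S := hS.configPart (k := .list) h₀ (by rw [hc]; rfl)
  rw [runs, Interp.holds_and, Interp.holds_conj]
  refine ⟨⟨⟨nat n, hS.headI hl⟩, ?_⟩,
    Interp.isRun_iff.1 (isRun_runInterp hr hS _) v, holds_haltRule_runInterp hr hS v⟩
  rw [Interp.holds_and, input, Interp.holds_exBut]
  refine ⟨holds_numeral_runInterp hS (by simp),
    assign ⟨nat n, hS.headI hl⟩ ⟨_, h₀⟩ ⟨_, hk⟩ ⟨_, hl⟩ ⟨_, hS.nil⟩ ⟨_, h₀⟩ ⟨_, h₀⟩ ⟨_, h₀⟩,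
    by simp, ?_⟩
  simp [hc]

theorem models_noHalt_runInterp (h : ∀ i, (r i).step ≠ none) :
    (runInterp r S lt).Models noHalt := by
  intro v
  rw [noHalt, Interp.holds_all]
  intro w
  rw [Interp.holds_neg, Interp.holds_lab, lab_runInterp]
  rcases w 0 with ⟨_ | (_ | _) | (_ | _) | (_ | _), _⟩ <;> simp
  rename_i i _
  have := h i
  cases hi : r i <;> simp_all [Config.step]

end

/-! ### The two reductions and undecidability. -/

theorem satOverWords_runs_iff (c : Code) (n : ℕ) :
    SatOverWords (runs c n) ↔ (c.eval [n]).Dom := by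
  constructor
  · rintro ⟨M, I, hI, h⟩
    have := hI.finite
    have := hI.nonempty
    exact Interp.eval_dom_of_models_runs h
  · rw [← Config.eval_step_dom, Config.eval_dom_iff]
    rintro ⟨N, hN⟩
    -- The times up to `N` suffice: the configuration at `N` is halting, so no successor beyond it
    -- is demanded.
    obtain ⟨S, hS, hT, -, hfin⟩ := exists_supports (Config.norm c .halt [n]).run (Set.Iic N)
      fun i hi h => Nat.lt_of_le_of_ne hi fun h' => h (h' ▸ hN)
    have : Finite S := hfin (Set.finite_Iic N)
    have h₀ := (hT 0).2 (Nat.zero_le N)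
    -- Any enumeration provides the order, since the sentence does not mention it.
    obtain ⟨m, ⟨e⟩⟩ := Finite.exists_equiv_fin S
    refine ⟨S, runInterp (Config.norm c .halt [n]).run S fun a b => e a < e b,
      ⟨this, ⟨⟨_, h₀⟩⟩, ?_, fun _ _ => Iff.rfl⟩,
      models_runs_runInterp (fun _ _ h => Config.run_succ h) hS h₀ rfl⟩
    exact (RelEmbedding.preimage e.toEmbedding (· < ·)).isStrictTotalOrder

theorem satOverOmegaWords_diverges_iff (c : Code) (n : ℕ) :
    SatOverOmegaWords (diverges c n) ↔ ¬ (c.eval [n]).Dom := by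
  constructor
  · rintro ⟨M, I, ⟨e, -⟩, h⟩
    have : Nonempty M := ⟨e 0⟩
    exact Interp.not_eval_dom_of_models_diverges h
  · rw [← Config.eval_step_dom, Config.eval_dom_iff]
    intro h
    push Not at h
    obtain ⟨S, hS, hT, hcount, -⟩ := exists_supports (Config.norm c .halt [n]).run Set.univ
      fun _ _ _ => trivial
    have hinj : Function.Injective fun i : ℕ => (⟨Elem.time i, (hT i).2 trivial⟩ : S) :=
      fun i j hij => by simpa using hij
    have : Infinite S := Infinite.of_injective _ hinj
    have : Countable S := hcount
    obtain ⟨e⟩ : Nonempty (ℕ ≃ S) := nonempty_equiv_of_countable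
    refine ⟨S, runInterp (Config.norm c .halt [n]).run S fun a b => e.symm a < e.symm b,
      ⟨e, fun i j => ⟨?_, ?_⟩⟩, fun v => ?_⟩
    · simp only [runInterp, Equiv.symm_apply_apply]
      constructor
      · rintro ⟨hij, hn⟩
        by_contra hne
        -- If `j` were larger than `i + 1`, the element at `i + 1` would lie strictly between.
        exact hn ⟨e (i + 1), by simp, by simp; omega⟩
      · rintro rfl
        refine ⟨by simp, ?_⟩
        rintro ⟨z, hz, hz'⟩
        omega
    · simp [runInterp]
    · rw [diverges, Interp.holds_and]
      exact ⟨models_runs_runInterp (fun _ _ h => Config.run_succ h) hS ((hT 0).2 trivial) rfl v,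
        models_noHalt_runInterp h v⟩

theorem not_decidableProblem_satOverWords {σ : Set BinSym} (hσ : BinSym.rel ∈ σ) :
    ¬ DecidableProblem (oneDimSentences σ) SatOverWords := by
  rintro ⟨p, hp, h⟩
  obtain ⟨c, hc⟩ := exists_code_not_computable
  refine hc (ComputablePred.computable_of_manyOneReducible
    ⟨runs c, (primrec_runs c).to_comp, fun n => ?_⟩ hp)
  rw [h _ (runs_mem hσ c n), satOverWords_runs_iff]

theorem not_decidableProblem_satOverOmegaWords {σ : Set BinSym} (hσ : BinSym.rel ∈ σ) :
    ¬ DecidableProblem (oneDimSentences σ) SatOverOmegaWords := by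
  rintro ⟨p, hp, h⟩
  obtain ⟨c, hc⟩ := exists_code_not_computable
  -- Here satisfiability expresses non-halting, so the reduction goes to the complement of the
  -- decision predicate.
  refine hc (ComputablePred.computable_of_manyOneReducible
    ⟨diverges c, (primrec_diverges c).to_comp, fun n => ?_⟩ hp.not)
  rw [h _ (diverges_mem hσ c n), satOverOmegaWords_diverges_iff, not_not]

end OneDim

theorem mainTheorem5 :
    (¬ OneDim.DecidableProblem (OneDim.Formula.oneDimSentences {.succ, .rel}) OneDim.SatOverWords ∧
      ¬ OneDim.DecidableProblem (OneDim.Formula.oneDimSentences {.succ, .rel})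
          OneDim.SatOverOmegaWords) ∧
    (¬ OneDim.DecidableProblem (OneDim.Formula.oneDimSentences {.less, .rel}) OneDim.SatOverWords ∧
      ¬ OneDim.DecidableProblem (OneDim.Formula.oneDimSentences {.less, .rel})
          OneDim.SatOverOmegaWords) :=
  ⟨⟨OneDim.not_decidableProblem_satOverWords (by simp),
    OneDim.not_decidableProblem_satOverOmegaWords (by simp)⟩,
    OneDim.not_decidableProblem_satOverWords (by simp),
    OneDim.not_decidableProblem_satOverOmegaWords (by simp)⟩
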